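/- Let $1\le p\le 2$ and $1/p+1/q=1$. Let $\sigma_1,\sigma_2\in L^p[0,1]$ be complex-valued and let $P=(p_{jk})_{j,k=1,2}$ be a matrix function on $[0,1]$ with complex-valued integrable entries (in particular, entries in $L^p[0,1]$ are allowed). For $\mu\in\mathbb C\setminus\{0\}$ put $$J(x)=\begin{bmatrix}0&\sigma_1(x)\\ \sigma_2(x)&0\end{bmatrix},\qquad A_\mu=i\mu\begin{bmatrix}1&0\\0&-1\end{bmatrix},$$ and consider on $[0,1]$ the Dirac system $Y'+JY=A_\mu Y$ and the perturbed system $Y'+JY=A_\mu Y+\frac1\mu PY$; solutions are absolutely continuous on $[0,1]$ and satisfy the equation a.e. A fundamental system is a basis of the space of solutions. Fix $r\ge0$ and let $\Sigma_r=\{\mu\in\mathbb C:\operatorname{Im}\mu>-r\}$. For $x\in[0,1]$ put $$g_1(x)=\int_0^xe^{2i\mu(x-t)}\sigma_1(t)\,dt,\qquad g_2(x)=\int_x^1e^{2i\mu(t-x)}\sigma_2(t)\,dt,$$ $$(K_1z)(x)=\int_0^x\sigma_1(t)\int_t^1e^{2i\mu(s-t)}\sigma_2(s)z(s)\,ds\,dt,\qquad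 (K_2z)(x)=\int_x^1\sigma_2(t)\int_0^te^{2i\mu(t-s)}\sigma_1(s)z(s)\,ds\,dt,$$ $e\equiv1$, $\gamma_{0,j}(x,\mu)=|g_j(x)|$, $\gamma_j(\mu)=\|\gamma_{0,j}(\cdot,\mu)\|_{L^q[0,1]}$, $$\tilde\gamma(\mu)=\int_0^1|\sigma_2(s)|\,\gamma_{0,1}^2(s,\mu)\,ds+\int_0^1|\sigma_1(s)|\,\gamma_{0,2}^2(s,\mu)\,ds,$$ $$k_P(\mu)=\int_0^1\|P(t)\|\bigl(\gamma_{0,1}(t,\mu)+\gamma_{0,2}(t,\mu)\bigr)dt,\qquad \rho(\mu)=|\mu|^{-1}k_P(\mu)+\gamma_1^2(\mu)+\gamma_2^2(\mu)+\tilde\gamma(\mu)+|\mu|^{-2},$$ where $\|P(t)\|=\max_{j,k}|p_{jk}(t)|$ (the choice of matrix norm is immaterial). Then for all $\mu\in\Sigma_r$ with $|\mu|$ sufficiently large the Dirac system has a fundamental system $W=(w_1,w_2)^T$, $V=(v_1,v_2)^T$ with $w_1(0)=1$, $w_2(1)=0$, $v_1(0)=0$, $v_2(1)=1$, and the perturbed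 system has a fundamental system $\widetilde W,\widetilde V$ such that, as $|\mu|\to\infty$ in $\Sigma_r$, uniformly in $x\in[0,1]$, $$\widetilde W=W+\frac{e^{i\mu x}}{\mu}\begin{bmatrix}g_1(x)\int_x^1e^{2i\mu(t-x)}p_{21}(t)\,dt\\[2pt]-\int_x^1e^{2i\mu(t-x)}p_{21}(t)\,dt\end{bmatrix}+\frac{e^{i\mu x}}{\mu}\begin{bmatrix}\int_0^xp_{11}(t)\,dt\\[2pt]g_2(x)\int_0^xp_{11}(t)\,dt\end{bmatrix}+e^{i\mu x}O(\rho(\mu)),$$ $$\widetilde V=V+\frac{e^{i\mu(1-x)}}{\mu}\begin{bmatrix}\int_0^xe^{2i\mu(x-t)}p_{12}(t)\,dt\\[2pt]g_2(x)\int_0^xe^{2i\mu(x-t)}p_{12}(t)\,dt\end{bmatrix}+\frac{e^{i\mu(1-x)}}{\mu}\begin{bmatrix}g_1(x)\int_x^1p_{22}(t)\,dt\\[2pt]-\int_x^1p_{22}(t)\,dt\end{bmatrix}+e^{i\mu(1-x)}O(\rho(\mu)),$$ and $$w_1=e^{i\mu x}\bigl(1-(K_1e)(x)+O(\tilde\gamma(\mu))\bigr),\qquad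 w_2=e^{i\mu x}\Bigl(g_2(x)-\int_x^1e^{2i\mu(t-x)}\sigma_2(t)(K_1e)(t)\,dt+O(\tilde\gamma(\mu))\Bigr),$$ $$v_1=e^{i\mu(1-x)}\Bigl(-g_1(x)+\int_0^xe^{2i\mu(x-t)}\sigma_1(t)(K_2e)(t)\,dt+O(\tilde\gamma(\mu))\Bigr),\qquad v_2=e^{i\mu(1-x)}\bigl(1-(K_2e)(x)+O(\tilde\gamma(\mu))\bigr).$$ The implied constants and the threshold for $|\mu|$ depend only on $p,r,\sigma_1,\sigma_2,P$. -/

import Mathlib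

open MeasureTheory Set
open scoped ENNReal Matrix

noncomputable section

namespace DiracSystem

/-- The open half-plane `Im μ > -r`. -/
def halfPlane (r : ℝ) : Set ℂ := {μ : ℂ | -r < μ.im}

/-- The matrix `A_μ = i μ diag(1, -1)`. -/
def matA (μ : ℂ) : Matrix (Fin 2) (Fin 2) ℂ :=
  !![Complex.I * μ, 0; 0, -(Complex.I * μ)]

/-- The off-diagonal potential with entries `σ₁` and `σ₂`. -/
def matJ (σ₁ σ₂ : ℝ → ℂ) (x : ℝ) : Matrix (Fin 2) (Fin 2) ℂ :=
  !![0, σ₁ x; σ₂ x, 0]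

/-- `Y` is a solution on `[0,1]` of `Y'(x) = M(x) Y(x)`: its components are absolutely
continuous on `[0,1]` and the equation holds almost everywhere. -/
def IsSolution (M : ℝ → Matrix (Fin 2) (Fin 2) ℂ) (Y : ℝ → Fin 2 → ℂ) : Prop :=
  (∀ i, AbsolutelyContinuousOnInterval (fun x => Y x i) 0 1) ∧
    ∀ᵐ x ∂(volume.restrict (Icc (0 : ℝ) 1)), HasDerivAt Y (M x *ᵥ Y x) x

/-- `Y`, `Z` form a basis of the space of solutions on `[0,1]` of the system with coefficient
matrix `M` (functions being identified when they agree on `[0,1]`). -/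
def IsFundamentalSystem (M : ℝ → Matrix (Fin 2) (Fin 2) ℂ) (Y Z : ℝ → Fin 2 → ℂ) : Prop :=
  IsSolution M Y ∧ IsSolution M Z ∧
    ∀ X : ℝ → Fin 2 → ℂ, IsSolution M X →
      ∃! c : ℂ × ℂ, ∀ x ∈ Icc (0 : ℝ) 1, X x = c.1 • Y x + c.2 • Z x

/-- Coefficient matrix of the Dirac system `Y' + J Y = A_μ Y`. -/
def diracMatrix (σ₁ σ₂ : ℝ → ℂ) (μ : ℂ) (x : ℝ) : Matrix (Fin 2) (Fin 2) ℂ :=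
  matA μ - matJ σ₁ σ₂ x

/-- Coefficient matrix of the perturbed Dirac system `Y' + J Y = A_μ Y + μ⁻¹ P Y`. -/
def perturbedMatrix (σ₁ σ₂ : ℝ → ℂ) (P : ℝ → Matrix (Fin 2) (Fin 2) ℂ) (μ : ℂ) (x : ℝ) :
    Matrix (Fin 2) (Fin 2) ℂ :=
  matA μ - matJ σ₁ σ₂ x + μ⁻¹ • P x

/-- `∫₀ˣ e^{2iμ(x-t)} f(t) dt`. -/
def leftInt (μ : ℂ) (f : ℝ → ℂ) (x : ℝ) : ℂ :=
  ∫ t in (0 : ℝ)..x, Complex.exp (2 * Complex.I * μ * ((x : ℂ) - (t : ℂ))) * f t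

/-- `∫ₓ¹ e^{2iμ(t-x)} f(t) dt`. -/
def rightInt (μ : ℂ) (f : ℝ → ℂ) (x : ℝ) : ℂ :=
  ∫ t in x..(1 : ℝ), Complex.exp (2 * Complex.I * μ * ((t : ℂ) - (x : ℂ))) * f t

/-- `(K₁ z)(x) = ∫₀ˣ σ₁(t) ∫ₜ¹ e^{2iμ(s-t)} σ₂(s) z(s) ds dt`. -/
def opK₁ (σ₁ σ₂ : ℝ → ℂ) (μ : ℂ) (z : ℝ → ℂ) (x : ℝ) : ℂ :=
  ∫ t in (0 : ℝ)..x, σ₁ t * rightInt μ (fun s => σ₂ s * z s) t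

/-- `(K₂ z)(x) = ∫ₓ¹ σ₂(t) ∫₀ᵗ e^{2iμ(t-s)} σ₁(s) z(s) ds dt`. -/
def opK₂ (σ₁ σ₂ : ℝ → ℂ) (μ : ℂ) (z : ℝ → ℂ) (x : ℝ) : ℂ :=
  ∫ t in x..(1 : ℝ), σ₂ t * leftInt μ (fun s => σ₁ s * z s) t

/-- The constant function `1`. -/
def oneFun : ℝ → ℂ := fun _ => 1

/-- `γ_{0,1}(x, μ)`. -/
def gamma₀₁ (σ₁ : ℝ → ℂ) (x : ℝ) (μ : ℂ) : ℝ := ‖leftInt μ σ₁ x‖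

/-- `γ_{0,2}(x, μ)`. -/
def gamma₀₂ (σ₂ : ℝ → ℂ) (x : ℝ) (μ : ℂ) : ℝ := ‖rightInt μ σ₂ x‖

/-- `γ₁(μ)`, the norm of `γ_{0,1}(·, μ)` in `L^q[0,1]`. -/
def gamma₁ (q : ℝ≥0∞) (σ₁ : ℝ → ℂ) (μ : ℂ) : ℝ :=
  (eLpNorm (fun x => gamma₀₁ σ₁ x μ) q (volume.restrict (Icc (0 : ℝ) 1))).toReal

/-- `γ₂(μ)`, the norm of `γ_{0,2}(·, μ)` in `L^q[0,1]`. -/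
def gamma₂ (q : ℝ≥0∞) (σ₂ : ℝ → ℂ) (μ : ℂ) : ℝ :=
  (eLpNorm (fun x => gamma₀₂ σ₂ x μ) q (volume.restrict (Icc (0 : ℝ) 1))).toReal

/-- `γ̃(μ) = ∫₀¹ |σ₂| γ_{0,1}² + ∫₀¹ |σ₁| γ_{0,2}²`. -/
def gammaTilde (σ₁ σ₂ : ℝ → ℂ) (μ : ℂ) : ℝ :=
  (∫ s in (0 : ℝ)..1, ‖σ₂ s‖ * gamma₀₁ σ₁ s μ ^ 2) +
    ∫ s in (0 : ℝ)..1, ‖σ₁ s‖ * gamma₀₂ σ₂ s μ ^ 2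

open scoped Matrix.Norms.Elementwise in
/-- `k_P(μ) = ∫₀¹ ‖P(t)‖ (γ_{0,1}(t, μ) + γ_{0,2}(t, μ)) dt`, where `‖P(t)‖` is the largest
modulus of an entry (all matrix norms being equivalent). -/
def kP (σ₁ σ₂ : ℝ → ℂ) (P : ℝ → Matrix (Fin 2) (Fin 2) ℂ) (μ : ℂ) : ℝ :=
  ∫ t in (0 : ℝ)..1, ‖P t‖ * (gamma₀₁ σ₁ t μ + gamma₀₂ σ₂ t μ)

/-- `ρ(μ) = |μ|⁻¹ k_P(μ) + γ₁(μ)² + γ₂(μ)² + γ̃(μ) + |μ|⁻²`. -/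
def rho (q : ℝ≥0∞) (σ₁ σ₂ : ℝ → ℂ) (P : ℝ → Matrix (Fin 2) (Fin 2) ℂ) (μ : ℂ) : ℝ :=
  ‖μ‖⁻¹ * kP σ₁ σ₂ P μ + gamma₁ q σ₁ μ ^ 2 + gamma₂ q σ₂ μ ^ 2 + gammaTilde σ₁ σ₂ μ
    + (‖μ‖ ^ 2)⁻¹

end DiracSystem

end

/-! Both systems have the form `coeffMatrix μ a b c d`. Writing `Y = e^{iμx} z` with data `z₁(0) =
k`, `z₂(1) = 0` turns them into `z₁ = k + ∫₀ˣ (c z₁ + a z₂)`, `z₂ = R(b z₁ + d z₂)`, where `R` is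
`rightInt μ` and `L` below is `leftInt μ`. Placing one condition at each endpoint leaves only the
kernels `e^{2iμ(s-t)}` with `0 ≤ s - t ≤ 1`, which are bounded by `e^{2r}` on the half-plane.

The resulting operator `T` is not small, but its square is. Integration by parts
(`integral_mul_rightInt`, `rightInt_mul_primitive`) moves the kernel in `T²` onto the coefficients,
producing factors `L(a)` and `R(b)`; these tend to zero uniformly in `x` by a Riemann–Lebesgue lemma
(`leftInt_small`, `rightInt_small`), while `c` and `d` carry the factor `1/μ`. So `T²` contracts by
1/2 for large `|μ|`. This gives existence (`SmallSystem.exists_solution`), the estimate `‖z‖ ≤ 2(1 +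
‖T‖)‖f‖` for `z = f + T z` (`SmallSystem.apriori`), and with `f = 0` uniqueness, hence the basis
property.

The asymptotics follow by inserting an approximate solution into the equation and applying the a
priori estimate to the error, whose inhomogeneity is the residual. Without perturbation one inserts
`(1 - K₁e, R(σ₂(1 - K₁e)))`; after integration by parts and Cauchy–Schwarz the residual is `O(γ̃)`.
For the difference of the perturbed and the unperturbed solution one inserts the explicit `1/μ`
term; every piece of the residual has a factor `1/μ` together with a second small factor, and
`remainder_le` collects them into `|μ|⁻¹ k_P + γ̃ + |μ|⁻²`.

The second solution is not treated separately: the reflection `x ↦ 1 - x` with interchanged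
components maps the problem for `V` to the one for `W`, with `σ₁, σ₂` replaced by `-σ₂(1 - ·), -σ₁(1
- ·)`. -/

namespace DiracSystem

/-! ### Absolutely continuous functions and their integrals -/

/-- A complex primitive of an integrable function is absolutely continuous. -/
theorem absolutelyContinuousOnInterval_primitive {f : ℝ → ℂ} {a b c : ℝ}
    (hf : IntervalIntegrable f volume a b) (hc : c ∈ uIcc a b) :
    AbsolutelyContinuousOnInterval (fun x => ∫ t in c..x, f t) a b := by
  -- Reduction to real-valued primitives, using `|z| ≤ |Re z| + |Im z|` on each increment.
  have hre : IntervalIntegrable (fun t => (f t).re) volume a b := ⟨hf.1.re, hf.2.re⟩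
  have him : IntervalIntegrable (fun t => (f t).im) volume a b := ⟨hf.1.im, hf.2.im⟩
  have hR := hre.absolutelyContinuousOnInterval_intervalIntegral hc
  have hI := him.absolutelyContinuousOnInterval_intervalIntegral hc
  rw [absolutelyContinuousOnInterval_iff] at hR hI ⊢
  intro ε hε
  obtain ⟨δ₁, hδ₁, h₁⟩ := hR (ε / 2) (by positivity)
  obtain ⟨δ₂, hδ₂, h₂⟩ := hI (ε / 2) (by positivity)
  refine ⟨min δ₁ δ₂, lt_min hδ₁ hδ₂, fun E hE hlt => ?_⟩
  have e₁ := h₁ E hE (hlt.trans_le (min_le_left _ _))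
  have e₂ := h₂ E hE (hlt.trans_le (min_le_right _ _))
  have key : ∀ i ∈ Finset.range E.1,
      dist (∫ t in c..(E.2 i).1, f t) (∫ t in c..(E.2 i).2, f t) ≤
        dist (∫ t in c..(E.2 i).1, (f t).re) (∫ t in c..(E.2 i).2, (f t).re) +
        dist (∫ t in c..(E.2 i).1, (f t).im) (∫ t in c..(E.2 i).2, (f t).im) := by
    intro i hi
    have hsub : ∀ y ∈ uIcc a b, IntervalIntegrable f volume c y := fun y hy =>
      hf.mono_set (uIcc_subset_uIcc hc hy)
    have hmem := hE.1 i hi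
    have hre' : ∀ y ∈ uIcc a b, (∫ t in c..y, f t).re = ∫ t in c..y, (f t).re := fun y hy => by
      simpa using (Complex.reCLM.intervalIntegral_comp_comm (hsub y hy)).symm
    have him' : ∀ y ∈ uIcc a b, (∫ t in c..y, f t).im = ∫ t in c..y, (f t).im := fun y hy => by
      simpa using (Complex.imCLM.intervalIntegral_comp_comm (hsub y hy)).symm
    rw [← hre' _ hmem.1, ← hre' _ hmem.2, ← him' _ hmem.1, ← him' _ hmem.2, dist_eq_norm,
      Real.dist_eq, Real.dist_eq, ← Complex.sub_re, ← Complex.sub_im]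
    exact Complex.norm_le_abs_re_add_abs_im _
  calc _ ≤ _ := Finset.sum_le_sum key
    _ < ε := by rw [Finset.sum_add_distrib]; linarith

/-- Fundamental theorem of calculus for absolutely continuous functions. -/
theorem AC_eq_add_integral {f f' : ℝ → ℂ} {a b : ℝ}
    (hf : AbsolutelyContinuousOnInterval f a b) (hf' : IntervalIntegrable f' volume a b)
    (hd : ∀ᵐ x, x ∈ uIcc a b → HasDerivAt f (f' x) x) {x : ℝ} (hx : x ∈ uIcc a b) :
    f x = f a + ∫ t in a..x, f' t := by
  have hg := hf.fun_sub (absolutelyContinuousOnInterval_primitive hf' left_mem_uIcc)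
  have hg0 : ∀ᵐ x, x ∈ uIcc a b → HasDerivAt (fun x => f x - ∫ t in a..x, f' t) 0 x := by
    filter_upwards [hd, hf'.ae_hasDerivAt_integral] with y h₁ h₂ hy
    simpa using (h₁ hy).fun_sub (h₂ hy a left_mem_uIcc)
  obtain ⟨C, hC⟩ := hg.const_of_ae_hasDerivAt_zero hg0
  have h₁ := hC x hx
  have h₂ := hC a left_mem_uIcc
  simp only [intervalIntegral.integral_same, sub_zero] at h₂
  rw [h₂]
  exact sub_eq_iff_eq_add.1 h₁

/-! ### Quantitative integrability and boundedness on `[0,1]` -/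

/-- `f` is integrable on `[0,1]` with `L¹` norm at most `K`. -/
structure L1Bound (f : ℝ → ℂ) (K : ℝ) : Prop where
  int : IntervalIntegrable f volume 0 1
  le : ∫ t in (0 : ℝ)..1, ‖f t‖ ≤ K

/-- `z` is continuous on `[0,1]` and bounded there by `M`. -/
structure SupBound (z : ℝ → ℂ) (M : ℝ) : Prop where
  cont : ContinuousOn z (Icc 0 1)
  le : ∀ x ∈ Icc (0 : ℝ) 1, ‖z x‖ ≤ M

theorem SupBound.nonneg {z : ℝ → ℂ} {M : ℝ} (h : SupBound z M) : 0 ≤ M :=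
  (norm_nonneg _).trans (h.le 0 (by simp))

theorem SupBound.mono {z : ℝ → ℂ} {M N : ℝ} (h : SupBound z M) (hMN : M ≤ N) : SupBound z N :=
  ⟨h.cont, fun x hx => (h.le x hx).trans hMN⟩

theorem SupBound.add {z w : ℝ → ℂ} {M N : ℝ} (h : SupBound z M) (h' : SupBound w N) :
    SupBound (fun x => z x + w x) (M + N) :=
  ⟨h.cont.add h'.cont, fun x hx => (norm_add_le _ _).trans (add_le_add (h.le x hx) (h'.le x hx))⟩

theorem SupBound.sub {z w : ℝ → ℂ} {M N : ℝ} (h : SupBound z M) (h' : SupBound w N) :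
    SupBound (fun x => z x - w x) (M + N) :=
  ⟨h.cont.sub h'.cont, fun x hx => (norm_sub_le _ _).trans (add_le_add (h.le x hx) (h'.le x hx))⟩

theorem SupBound.neg {z : ℝ → ℂ} {M : ℝ} (h : SupBound z M) : SupBound (fun x => -z x) M :=
  ⟨h.cont.neg, fun x hx => by simpa using h.le x hx⟩

theorem SupBound.mul {z w : ℝ → ℂ} {M N : ℝ} (h : SupBound z M) (h' : SupBound w N) :
    SupBound (fun x => z x * w x) (M * N) :=
  ⟨h.cont.mul h'.cont, fun x hx => by
    rw [norm_mul]
    exact mul_le_mul (h.le x hx) (h'.le x hx) (norm_nonneg _) h.nonneg⟩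

theorem SupBound.const_mul {z : ℝ → ℂ} {M : ℝ} (k : ℂ) (h : SupBound z M) :
    SupBound (fun x => k * z x) (‖k‖ * M) :=
  ⟨continuousOn_const.mul h.cont, fun x hx => by
    rw [norm_mul]
    exact mul_le_mul_of_nonneg_left (h.le x hx) (norm_nonneg _)⟩

theorem SupBound.congr {z w : ℝ → ℂ} {M : ℝ} (h : SupBound z M)
    (hzw : ∀ x ∈ Icc (0 : ℝ) 1, w x = z x) : SupBound w M :=
  ⟨h.cont.congr hzw, fun x hx => by rw [hzw x hx]; exact h.le x hx⟩

theorem supBound_const (k : ℂ) : SupBound (fun _ => k) ‖k‖ :=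
  ⟨continuousOn_const, fun _ _ => le_rfl⟩

theorem L1Bound.nonneg {f : ℝ → ℂ} {K : ℝ} (h : L1Bound f K) : 0 ≤ K :=
  (intervalIntegral.integral_nonneg zero_le_one fun _ _ => norm_nonneg _).trans h.le

theorem L1Bound.mono {f : ℝ → ℂ} {K K' : ℝ} (h : L1Bound f K) (hK : K ≤ K') : L1Bound f K' :=
  ⟨h.int, h.le.trans hK⟩

theorem L1Bound.of_le {f : ℝ → ℂ} {g : ℝ → ℝ} (hf : IntervalIntegrable f volume 0 1)
    (hg : IntervalIntegrable g volume 0 1) (h : ∀ x ∈ Icc (0 : ℝ) 1, ‖f x‖ ≤ g x) :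
    L1Bound f (∫ t in (0 : ℝ)..1, g t) :=
  ⟨hf, intervalIntegral.integral_mono_on zero_le_one hf.norm hg h⟩

theorem L1Bound.add {f g : ℝ → ℂ} {K K' : ℝ} (h : L1Bound f K) (h' : L1Bound g K') :
    L1Bound (fun x => f x + g x) (K + K') := by
  refine (L1Bound.of_le (h.int.add h'.int) (h.int.norm.add h'.int.norm)
    fun x _ => norm_add_le _ _).mono ?_
  rw [intervalIntegral.integral_add h.int.norm h'.int.norm]
  exact add_le_add h.le h'.le

theorem L1Bound.neg {f : ℝ → ℂ} {K : ℝ} (h : L1Bound f K) : L1Bound (fun x => -f x) K :=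
  ⟨h.int.neg, by simpa using h.le⟩

theorem L1Bound.sub {f g : ℝ → ℂ} {K K' : ℝ} (h : L1Bound f K) (h' : L1Bound g K') :
    L1Bound (fun x => f x - g x) (K + K') := by
  simpa only [sub_eq_add_neg] using h.add h'.neg

theorem L1Bound.const_mul {f : ℝ → ℂ} {K : ℝ} (k : ℂ) (h : L1Bound f K) :
    L1Bound (fun x => k * f x) (‖k‖ * K) := by
  refine ⟨h.int.const_mul k, ?_⟩
  simp only [norm_mul, intervalIntegral.integral_const_mul]
  exact mul_le_mul_of_nonneg_left h.le (norm_nonneg _)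

theorem intervalIntegrable_mul_cont {f z : ℝ → ℂ} (hf : IntervalIntegrable f volume 0 1)
    (hz : ContinuousOn z (Icc 0 1)) : IntervalIntegrable (fun x => f x * z x) volume 0 1 :=
  hf.mul_continuousOn (by rwa [uIcc_of_le zero_le_one])

theorem L1Bound.mul {f z : ℝ → ℂ} {K M : ℝ} (h : L1Bound f K) (hz : SupBound z M) :
    L1Bound (fun x => f x * z x) (K * M) := by
  refine (L1Bound.of_le (intervalIntegrable_mul_cont h.int hz.cont) (h.int.norm.mul_const M)
    fun x hx => ?_).mono ?_
  · rw [norm_mul]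
    exact mul_le_mul_of_nonneg_left (hz.le x hx) (norm_nonneg _)
  · rw [intervalIntegral.integral_mul_const]
    exact mul_le_mul_of_nonneg_right h.le hz.nonneg

theorem intervalIntegrable_left {f : ℝ → ℂ} (hf : IntervalIntegrable f volume 0 1) {x : ℝ}
    (hx : x ∈ Icc (0 : ℝ) 1) : IntervalIntegrable f volume 0 x :=
  hf.mono_set (by rw [uIcc_of_le hx.1, uIcc_of_le zero_le_one]; exact Icc_subset_Icc_right hx.2)

theorem intervalIntegrable_right {f : ℝ → ℂ} (hf : IntervalIntegrable f volume 0 1) {x : ℝ}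
    (hx : x ∈ Icc (0 : ℝ) 1) : IntervalIntegrable f volume x 1 :=
  hf.mono_set (by rw [uIcc_of_le hx.2, uIcc_of_le zero_le_one]; exact Icc_subset_Icc_left hx.1)

/-- The primitive of an integrable function is bounded by the `L¹` norm. -/
theorem L1Bound.primitive {f : ℝ → ℂ} {K : ℝ} (h : L1Bound f K) :
    SupBound (fun x => ∫ t in (0 : ℝ)..x, f t) K := by
  refine ⟨?_, fun x hx => ?_⟩
  · simpa [uIcc_of_le] using (absolutelyContinuousOnInterval_primitive h.int left_mem_uIcc).continuousOn
  · refine (intervalIntegral.norm_integral_le_integral_norm hx.1).trans (le_trans ?_ h.le)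
    exact intervalIntegral.integral_mono_interval le_rfl hx.1 hx.2
      (Filter.Eventually.of_forall fun _ => norm_nonneg _) h.int.norm

/-! ### The exponential kernels -/

/-- The exponent has real part `-2 (Im μ)(s - t)`, and `Im μ > -r` with `0 ≤ s - t ≤ 1`. This is the
only way the half-plane enters the bounds. -/
theorem norm_exp_kernel_le {r : ℝ} (hr : 0 ≤ r) {μ : ℂ} (hμ : μ ∈ halfPlane r) {s t : ℝ}
    (h₀ : 0 ≤ s - t) (h₁ : s - t ≤ 1) :
    ‖Complex.exp (2 * Complex.I * μ * ((s : ℂ) - t))‖ ≤ Real.exp (2 * r) := by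
  rw [Complex.norm_exp]
  apply Real.exp_le_exp.2
  have : (2 * Complex.I * μ * ((s : ℂ) - t)).re = -2 * μ.im * (s - t) := by
    rw [← Complex.ofReal_sub]
    simp [Complex.mul_re, Complex.mul_im]
  rw [this]
  have hμ' : -r < μ.im := hμ
  nlinarith [mul_nonneg (by linarith : 0 ≤ μ.im + r) h₀]

/-- Separating the variables makes `leftInt` an exponential times a primitive. The separate factors
are not bounded uniformly in `μ`, so this serves differentiation at fixed `μ` only. -/
theorem leftInt_eq (μ : ℂ) (f : ℝ → ℂ) (x : ℝ) :
    leftInt μ f x = Complex.exp (2 * Complex.I * μ * x) *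
      ∫ t in (0 : ℝ)..x, Complex.exp (-(2 * Complex.I * μ * t)) * f t := by
  rw [leftInt, ← intervalIntegral.integral_const_mul]
  congr 1
  ext t
  rw [← mul_assoc, ← Complex.exp_add]
  ring_nf

theorem rightInt_eq (μ : ℂ) (f : ℝ → ℂ) (x : ℝ) :
    rightInt μ f x = Complex.exp (-(2 * Complex.I * μ * x)) *
      ∫ t in x..(1 : ℝ), Complex.exp (2 * Complex.I * μ * t) * f t := by
  rw [rightInt, ← intervalIntegral.integral_const_mul]
  congr 1
  ext t
  rw [← mul_assoc, ← Complex.exp_add]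
  ring_nf

/-- The substitution `t ↦ 1 - t` exchanges the two kernels, so each estimate is proved for one of
them and transferred. -/
theorem leftInt_comp_sub (μ : ℂ) (f : ℝ → ℂ) (x : ℝ) :
    leftInt μ (fun t => f (1 - t)) x = rightInt μ f (1 - x) := by
  have h := intervalIntegral.integral_comp_sub_left (a := 0) (b := x)
    (fun t => Complex.exp (2 * Complex.I * μ * ((t : ℂ) - ((1 - x : ℝ) : ℂ))) * f t) 1
  rw [sub_zero] at h
  rw [leftInt, rightInt, ← h]
  congr 1
  ext t
  push_cast
  ring_nf

theorem rightInt_comp_sub (μ : ℂ) (f : ℝ → ℂ) (x : ℝ) :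
    rightInt μ (fun t => f (1 - t)) x = leftInt μ f (1 - x) := by
  have h := leftInt_comp_sub μ (fun t => f (1 - t)) (1 - x)
  simpa using h.symm

theorem leftInt_neg (μ : ℂ) (f : ℝ → ℂ) (x : ℝ) :
    leftInt μ (fun t => -f t) x = -leftInt μ f x := by
  simp [leftInt]

theorem rightInt_neg (μ : ℂ) (f : ℝ → ℂ) (x : ℝ) :
    rightInt μ (fun t => -f t) x = -rightInt μ f x := by
  simp [rightInt]

theorem rightInt_one (μ : ℂ) (f : ℝ → ℂ) : rightInt μ f 1 = 0 := by
  simp [rightInt]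

theorem leftInt_zero (μ : ℂ) (f : ℝ → ℂ) : leftInt μ f 0 = 0 := by
  simp [leftInt]

theorem intervalIntegrable_exp_mul (k : ℂ) {f : ℝ → ℂ} (hf : IntervalIntegrable f volume 0 1) :
    IntervalIntegrable (fun t : ℝ => Complex.exp (k * t) * f t) volume 0 1 :=
  hf.continuousOn_mul (by fun_prop)

theorem absolutelyContinuousOnInterval_exp (k : ℂ) (a b : ℝ) :
    AbsolutelyContinuousOnInterval (fun x : ℝ => Complex.exp (k * x)) a b := by
  have h : ContDiff ℝ 1 (fun x : ℝ => Complex.exp (k * x)) :=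
    (contDiff_const.mul Complex.ofRealCLM.contDiff).cexp
  exact h.contDiffOn.absolutelyContinuousOnInterval

theorem hasDerivAt_exp_mul (k : ℂ) (x : ℝ) :
    HasDerivAt (fun x : ℝ => Complex.exp (k * x)) (k * Complex.exp (k * x)) x := by
  have h := ((Complex.ofRealCLM.hasDerivAt (x := x)).const_mul k).cexp
  simpa [mul_comm] using h

theorem kernel_left {f : ℝ → ℂ} (μ : ℂ) (hf : IntervalIntegrable f volume 0 1) :
    AbsolutelyContinuousOnInterval (leftInt μ f) 0 1 ∧
    ∀ᵐ x, x ∈ uIcc (0 : ℝ) 1 →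
      HasDerivAt (leftInt μ f) (2 * Complex.I * μ * leftInt μ f x + f x) x := by
  have hfun : leftInt μ f = fun x : ℝ => Complex.exp (2 * Complex.I * μ * x) *
      ∫ t in (0 : ℝ)..x, Complex.exp (-(2 * Complex.I * μ) * t) * f t := by
    ext x; rw [leftInt_eq]; simp only [neg_mul]
  have hint := intervalIntegrable_exp_mul (-(2 * Complex.I * μ)) hf
  constructor
  · rw [hfun]
    exact (absolutelyContinuousOnInterval_exp _ 0 1).fun_smul
      (absolutelyContinuousOnInterval_primitive hint left_mem_uIcc)
  · filter_upwards [hint.ae_hasDerivAt_integral] with x hx hxm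
    have h := (hasDerivAt_exp_mul (2 * Complex.I * μ) x).fun_mul (hx hxm 0 left_mem_uIcc)
    rw [hfun]
    convert! h using 1
    rw [← mul_assoc (Complex.exp _) (Complex.exp _), ← Complex.exp_add]
    simp [mul_assoc]

theorem kernel_right {f : ℝ → ℂ} (μ : ℂ) (hf : IntervalIntegrable f volume 0 1) :
    AbsolutelyContinuousOnInterval (rightInt μ f) 0 1 ∧
    ∀ᵐ x, x ∈ uIcc (0 : ℝ) 1 →
      HasDerivAt (rightInt μ f) (-(2 * Complex.I * μ * rightInt μ f x) - f x) x := by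
  have hfun : rightInt μ f = fun x : ℝ => -(Complex.exp (-(2 * Complex.I * μ) * x) *
      ∫ t in (1 : ℝ)..x, Complex.exp (2 * Complex.I * μ * t) * f t) := by
    ext x; rw [rightInt_eq, intervalIntegral.integral_symm]; simp only [neg_mul, mul_neg]
  have hint := intervalIntegrable_exp_mul (2 * Complex.I * μ) hf
  constructor
  · rw [hfun]
    exact ((absolutelyContinuousOnInterval_exp _ 0 1).fun_smul
      (absolutelyContinuousOnInterval_primitive hint right_mem_uIcc)).fun_neg
  · filter_upwards [hint.ae_hasDerivAt_integral] with x hx hxm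
    have h := ((hasDerivAt_exp_mul (-(2 * Complex.I * μ)) x).fun_mul
      (hx hxm 1 right_mem_uIcc)).fun_neg
    rw [hfun]
    convert! h using 1
    rw [← mul_assoc (Complex.exp _) (Complex.exp _), ← Complex.exp_add]
    simp [mul_assoc]
    ring

theorem continuousOn_leftInt (μ : ℂ) {f : ℝ → ℂ} (hf : IntervalIntegrable f volume 0 1) :
    ContinuousOn (leftInt μ f) (Icc 0 1) := by
  simpa [uIcc_of_le] using (kernel_left μ hf).1.continuousOn

theorem continuousOn_rightInt (μ : ℂ) {f : ℝ → ℂ} (hf : IntervalIntegrable f volume 0 1) :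
    ContinuousOn (rightInt μ f) (Icc 0 1) := by
  simpa [uIcc_of_le] using (kernel_right μ hf).1.continuousOn

theorem L1Bound.rightInt {r : ℝ} (hr : 0 ≤ r) {μ : ℂ} (hμ : μ ∈ halfPlane r) {f : ℝ → ℂ} {K : ℝ}
    (h : L1Bound f K) : SupBound (rightInt μ f) (Real.exp (2 * r) * K) := by
  refine ⟨continuousOn_rightInt μ h.int, fun x hx => ?_⟩
  have hK : ∫ t in x..(1 : ℝ), ‖f t‖ ≤ K := (intervalIntegral.integral_mono_interval hx.1 hx.2
    le_rfl (Filter.Eventually.of_forall fun _ => norm_nonneg _) h.int.norm).trans h.le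
  refine (intervalIntegral.norm_integral_le_of_norm_le hx.2
    (g := fun t => Real.exp (2 * r) * ‖f t‖) (Filter.Eventually.of_forall fun t ht => ?_)
    ((intervalIntegrable_right h.int hx).norm.const_mul _)).trans ?_
  · rw [norm_mul]
    refine mul_le_mul_of_nonneg_right ?_ (norm_nonneg _)
    exact norm_exp_kernel_le hr hμ (by linarith [ht.1]) (by linarith [ht.2, hx.1])
  · rw [intervalIntegral.integral_const_mul]
    exact mul_le_mul_of_nonneg_left hK (Real.exp_nonneg _)

theorem intervalIntegrable_comp_sub {f : ℝ → ℂ} (hf : IntervalIntegrable f volume 0 1) :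
    IntervalIntegrable (fun t => f (1 - t)) volume 0 1 := by
  simpa using (hf.comp_sub_left 1).symm

theorem integral_comp_one_sub {E : Type*} [NormedAddCommGroup E] [NormedSpace ℝ E] (f : ℝ → E) :
    ∫ t in (0 : ℝ)..1, f (1 - t) = ∫ t in (0 : ℝ)..1, f t := by
  simp

theorem L1Bound.comp_sub {f : ℝ → ℂ} {K : ℝ} (h : L1Bound f K) :
    L1Bound (fun t => f (1 - t)) K :=
  ⟨intervalIntegrable_comp_sub h.int, by
    rw [integral_comp_one_sub fun t => ‖f t‖]; exact h.le⟩

theorem one_sub_mem {x : ℝ} (hx : x ∈ Icc (0 : ℝ) 1) : 1 - x ∈ Icc (0 : ℝ) 1 :=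
  ⟨by linarith [hx.2], by linarith [hx.1]⟩

theorem L1Bound.leftInt {r : ℝ} (hr : 0 ≤ r) {μ : ℂ} (hμ : μ ∈ halfPlane r) {f : ℝ → ℂ} {K : ℝ}
    (h : L1Bound f K) : SupBound (leftInt μ f) (Real.exp (2 * r) * K) := by
  refine ⟨continuousOn_leftInt μ h.int, fun x hx => ?_⟩
  have := (h.comp_sub.rightInt hr hμ).le (1 - x) (one_sub_mem hx)
  rwa [rightInt_comp_sub, sub_sub_cancel] at this

theorem rightInt_add (μ : ℂ) {f g : ℝ → ℂ} (hf : IntervalIntegrable f volume 0 1)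
    (hg : IntervalIntegrable g volume 0 1) {x : ℝ} (hx : x ∈ Icc (0 : ℝ) 1) :
    rightInt μ (fun t => f t + g t) x = rightInt μ f x + rightInt μ g x := by
  rw [rightInt, rightInt, rightInt, ← intervalIntegral.integral_add]
  · simp only [mul_add]
  · exact (intervalIntegrable_right hf hx).continuousOn_mul (by fun_prop)
  · exact (intervalIntegrable_right hg hx).continuousOn_mul (by fun_prop)

theorem rightInt_sub (μ : ℂ) {f g : ℝ → ℂ} (hf : IntervalIntegrable f volume 0 1)
    (hg : IntervalIntegrable g volume 0 1) {x : ℝ} (hx : x ∈ Icc (0 : ℝ) 1) :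
    rightInt μ (fun t => f t - g t) x = rightInt μ f x - rightInt μ g x := by
  rw [rightInt, rightInt, rightInt, ← intervalIntegral.integral_sub]
  · simp only [mul_sub]
  · exact (intervalIntegrable_right hf hx).continuousOn_mul (by fun_prop)
  · exact (intervalIntegrable_right hg hx).continuousOn_mul (by fun_prop)

theorem rightInt_const_mul (μ k : ℂ) (f : ℝ → ℂ) (x : ℝ) :
    rightInt μ (fun t => k * f t) x = k * rightInt μ f x := by
  rw [rightInt, rightInt, ← intervalIntegral.integral_const_mul]
  congr 1
  ext t
  ring

theorem rightInt_congr (μ : ℂ) {f g : ℝ → ℂ} (h : ∀ t ∈ Icc (0 : ℝ) 1, f t = g t) {x : ℝ}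
    (hx : x ∈ Icc (0 : ℝ) 1) : rightInt μ f x = rightInt μ g x := by
  refine intervalIntegral.integral_congr fun t ht => ?_
  rw [uIcc_of_le hx.2] at ht
  simp only [h t ⟨hx.1.trans ht.1, ht.2⟩]

theorem primitive_congr {f g : ℝ → ℂ} (h : ∀ t ∈ Icc (0 : ℝ) 1, f t = g t) {x : ℝ}
    (hx : x ∈ Icc (0 : ℝ) 1) : ∫ t in (0 : ℝ)..x, f t = ∫ t in (0 : ℝ)..x, g t := by
  refine intervalIntegral.integral_congr fun t ht => ?_
  rw [uIcc_of_le hx.1] at ht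
  exact h t ⟨ht.1, ht.2.trans hx.2⟩

/-- `rightInt μ f` is the only absolutely continuous solution of `u' = -2iμu - f` with
`u(1) = 0`. -/
theorem eq_rightInt {μ : ℂ} {u f : ℝ → ℂ} (hu : AbsolutelyContinuousOnInterval u 0 1)
    (hf : IntervalIntegrable f volume 0 1)
    (hd : ∀ᵐ x, x ∈ uIcc (0 : ℝ) 1 → HasDerivAt u (-(2 * Complex.I * μ * u x) - f x) x)
    (h₁ : u 1 = 0) {x : ℝ} (hx : x ∈ Icc (0 : ℝ) 1) : u x = rightInt μ f x := by
  -- The difference of the two solutions times `e^{2iμx}` has zero derivative. The interval is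
  -- oriented from 1 to 0 because the initial value is prescribed at 1.
  have hac := (absolutelyContinuousOnInterval_exp (2 * Complex.I * μ) 1 0).fun_smul
    (hu.symm.fun_sub (kernel_right μ hf).1.symm)
  have h := AC_eq_add_integral (f' := fun _ => 0) hac (by simp) (x := x) (by
    filter_upwards [hd, (kernel_right μ hf).2] with y h₁ h₂ hy
    rw [uIcc_comm] at hy
    have := (hasDerivAt_exp_mul (2 * Complex.I * μ) y).fun_mul ((h₁ hy).fun_sub (h₂ hy))
    simp only [smul_eq_mul]
    convert! this using 1
    ring) (by rw [uIcc_comm, uIcc_of_le zero_le_one]; exact hx)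
  simp only [h₁, rightInt_one, sub_zero, intervalIntegral.integral_zero, add_zero,
    smul_eq_mul, mul_zero] at h
  exact sub_eq_zero.1 ((mul_eq_zero.1 h).resolve_left (Complex.exp_ne_zero _))

/-- Integration by parts: `∫₀ˣ a R(b) = ∫₀ˣ b L(a) + L(a)(x) R(b)(x)`. -/
theorem integral_mul_rightInt (μ : ℂ) {a b : ℝ → ℂ} (ha : IntervalIntegrable a volume 0 1)
    (hb : IntervalIntegrable b volume 0 1) {x : ℝ} (hx : x ∈ Icc (0 : ℝ) 1) :
    ∫ t in (0 : ℝ)..x, a t * rightInt μ b t =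
      (∫ t in (0 : ℝ)..x, b t * leftInt μ a t) + leftInt μ a x * rightInt μ b x := by
  have i₁ := intervalIntegrable_mul_cont ha (continuousOn_rightInt μ hb)
  have i₂ := intervalIntegrable_mul_cont hb (continuousOn_leftInt μ ha)
  -- In the derivative of `L(a) R(b)` the terms `±2iμ L(a) R(b)` cancel, leaving `a R(b) - b L(a)`;
  -- the product vanishes at 0.
  have h := AC_eq_add_integral ((kernel_left μ ha).1.fun_smul (kernel_right μ hb).1)
    (i₁.sub i₂) (x := x) (by
      filter_upwards [(kernel_left μ ha).2, (kernel_right μ hb).2] with y h₁ h₂ hy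
      have := (h₁ hy).fun_mul (h₂ hy)
      simp only [smul_eq_mul]
      convert! this using 1
      ring) (by rw [uIcc_of_le zero_le_one]; exact hx)
  rw [intervalIntegral.integral_sub (intervalIntegrable_left i₁ hx)
    (intervalIntegrable_left i₂ hx)] at h
  simp only [leftInt_zero, smul_eq_mul, zero_mul] at h
  rw [h]
  ring

/-- Integration by parts: `R(b ∫₀ a)(x) = R(b)(x) ∫₀ˣ a + R(a R(b))(x)`. -/
theorem rightInt_mul_primitive (μ : ℂ) {a b : ℝ → ℂ} (ha : IntervalIntegrable a volume 0 1)
    (hb : IntervalIntegrable b volume 0 1) {x : ℝ} (hx : x ∈ Icc (0 : ℝ) 1) :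
    rightInt μ (fun t => b t * ∫ s in (0 : ℝ)..t, a s) x =
      rightInt μ b x * (∫ t in (0 : ℝ)..x, a t) +
        rightInt μ (fun t => a t * rightInt μ b t) x := by
  have hA := absolutelyContinuousOnInterval_primitive ha (left_mem_uIcc (a := (0 : ℝ)) (b := 1))
  have hAc : ContinuousOn (fun t => ∫ s in (0 : ℝ)..t, a s) (Icc 0 1) := by
    simpa [uIcc_of_le] using hA.continuousOn
  have i₁ := intervalIntegrable_mul_cont ha (continuousOn_rightInt μ hb)
  have i₂ := intervalIntegrable_mul_cont hb hAc
  -- `R(b) ∫₀ a` vanishes at 1 and solves `u' = -2iμu - (b ∫₀ a - a R(b))`, so uniqueness identifies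
  -- it.
  have h := eq_rightInt (μ := μ) ((kernel_right μ hb).1.fun_smul hA) (i₂.sub i₁) (by
    filter_upwards [ha.ae_hasDerivAt_integral, (kernel_right μ hb).2] with y h₁ h₂ hy
    have := (h₂ hy).fun_mul (h₁ hy 0 left_mem_uIcc)
    simp only [smul_eq_mul]
    convert! this using 1
    ring) (by simp [rightInt_one]) hx
  rw [rightInt_sub μ i₂ i₁ hx] at h
  simp only [smul_eq_mul] at h
  rw [h]
  ring

/-! ### The Riemann–Lebesgue lemma in the half-plane -/

/-- Integrating `d/dt (e^{2iμ(x-t)} g(t))` over `[0,x]`: for smooth `g` this gains the factor `1/μ`.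
-/
theorem leftInt_of_contDiff {μ : ℂ} {g : ℝ → ℂ} (hg : ContDiff ℝ 1 g) (x : ℝ) :
    2 * Complex.I * μ * leftInt μ g x =
      Complex.exp (2 * Complex.I * μ * ((x : ℂ) - ((0 : ℝ) : ℂ))) * g 0 - g x
        + leftInt μ (deriv g) x := by
  have hd : ∀ t : ℝ, HasDerivAt
      (fun t : ℝ => Complex.exp (2 * Complex.I * μ * ((x : ℂ) - t)) * g t)
      (-(2 * Complex.I * μ) * (Complex.exp (2 * Complex.I * μ * ((x : ℂ) - t)) * g t) +
        Complex.exp (2 * Complex.I * μ * ((x : ℂ) - t)) * deriv g t) t := by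
    intro t
    have h₁ := (((Complex.ofRealCLM.hasDerivAt (x := t)).const_sub (x : ℂ)).const_mul
      (2 * Complex.I * μ)).cexp
    have h₂ := h₁.fun_mul ((hg.differentiable one_ne_zero) t).hasDerivAt
    convert! h₂ using 1
    simp
    ring
  have hc : Continuous (deriv g) := hg.continuous_deriv le_rfl
  have hgc := hg.continuous
  have i₁ : IntervalIntegrable (fun t : ℝ => -(2 * Complex.I * μ) *
      (Complex.exp (2 * Complex.I * μ * ((x : ℂ) - t)) * g t)) volume 0 x :=
    Continuous.intervalIntegrable (by fun_prop) _ _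
  have i₂ : IntervalIntegrable (fun t : ℝ =>
      Complex.exp (2 * Complex.I * μ * ((x : ℂ) - t)) * deriv g t) volume 0 x :=
    Continuous.intervalIntegrable (by fun_prop) _ _
  have h := intervalIntegral.integral_eq_sub_of_hasDerivAt (fun t _ => hd t) (i₁.add i₂)
  rw [intervalIntegral.integral_add i₁ i₂, intervalIntegral.integral_const_mul] at h
  simp only [sub_self, mul_zero, Complex.exp_zero, one_mul] at h
  simp only [leftInt]
  linear_combination -h

/-- Uniform Riemann–Lebesgue lemma for `leftInt`. -/
theorem leftInt_small {r : ℝ} (hr : 0 ≤ r) {f : ℝ → ℂ} (hf : IntervalIntegrable f volume 0 1)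
    {ε : ℝ} (hε : 0 < ε) :
    ∃ R : ℝ, ∀ μ ∈ halfPlane r, R < ‖μ‖ → SupBound (leftInt μ f) ε := by
  set E := Real.exp (2 * r)
  have hE : 0 < E := Real.exp_pos _
  have hfm : MemLp f 1 (volume.restrict (Ioc (0 : ℝ) 1)) := memLp_one_iff_integrable.2 hf.1
  -- Smooth approximation in `L¹`: the error `ε/(2E)` becomes at most `ε/2` after the kernel bound
  -- `E`, uniformly in `μ`.
  obtain ⟨g, -, hg, hfg⟩ := hfm.exist_eLpNorm_sub_le ENNReal.one_ne_top le_rfl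
    (show (0 : ℝ) < ε / (2 * E) by positivity)
  have hg1 : ContDiff ℝ 1 g := hg.of_le (by exact_mod_cast le_top)
  have hgi : IntervalIntegrable g volume 0 1 := hg.continuous.intervalIntegrable _ _
  have hdi : IntervalIntegrable (deriv g) volume 0 1 :=
    (hg1.continuous_deriv le_rfl).intervalIntegrable _ _
  have hd : L1Bound (fun t => f t - g t) (ε / (2 * E)) := by
    refine ⟨hf.sub hgi, ?_⟩
    have h2 : Integrable (f - g) (volume.restrict (Ioc (0 : ℝ) 1)) := (hf.sub hgi).1
    rw [eLpNorm_one_eq_lintegral_enorm, ← ofReal_integral_norm_eq_lintegral_enorm h2,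
      ENNReal.ofReal_le_ofReal_iff (by positivity)] at hfg
    rw [intervalIntegral.integral_of_le zero_le_one]
    exact hfg
  have hgd : L1Bound (deriv g) (∫ t in (0 : ℝ)..1, ‖deriv g t‖) := ⟨hdi, le_rfl⟩
  obtain ⟨M, hM⟩ := isCompact_Icc.exists_bound_of_continuousOn
    (hg.continuous.continuousOn (s := Icc (0 : ℝ) 1))
  -- Bound for the three terms on the right of `leftInt_of_contDiff`, so that `2‖μ‖ ‖leftInt μ g x‖
  -- ≤ D`.
  set D := E * M + M + E * ∫ t in (0 : ℝ)..1, ‖deriv g t‖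
  have hM0 : 0 ≤ M := (norm_nonneg _).trans (hM 0 (by simp))
  have hD : 0 ≤ D := by have := hgd.nonneg; positivity
  refine ⟨D / ε, fun μ hμ hlt => ⟨continuousOn_leftInt μ hf, fun x hx => ?_⟩⟩
  have hlt' : D < ε * ‖μ‖ := by rwa [div_lt_iff₀' hε] at hlt
  have hμ0 : 0 < ‖μ‖ := lt_of_le_of_lt (by positivity) hlt
  have h₁ : ‖leftInt μ (fun t => f t - g t) x‖ ≤ ε / 2 := by
    refine ((hd.leftInt hr hμ).le x hx).trans (le_of_eq ?_)
    change E * _ = _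
    field_simp
  have h₂ : ‖leftInt μ g x‖ ≤ ε / 2 := by
    have e := congrArg norm (leftInt_of_contDiff (μ := μ) hg1 x)
    have e₁ : ‖Complex.exp (2 * Complex.I * μ * ((x : ℂ) - ((0 : ℝ) : ℂ))) * g 0‖ ≤ E * M := by
      rw [norm_mul]
      exact mul_le_mul (norm_exp_kernel_le hr hμ (by simpa using hx.1) (by simpa using hx.2))
        (hM 0 (by simp)) (norm_nonneg _) hE.le
    have e₂ : 2 * ‖μ‖ * ‖leftInt μ g x‖ ≤ D := by
      calc _ = ‖2 * Complex.I * μ * leftInt μ g x‖ := by simp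
        _ ≤ _ := by
          rw [e]
          refine (norm_add_le _ _).trans (add_le_add ((norm_sub_le _ _).trans
            (add_le_add e₁ (hM x hx))) ((hgd.leftInt hr hμ).le x hx))
    have : 2 * ‖μ‖ * ‖leftInt μ g x‖ ≤ 2 * ‖μ‖ * (ε / 2) := by nlinarith
    exact le_of_mul_le_mul_left this (by positivity)
  have hsplit : leftInt μ f x = leftInt μ (fun t => f t - g t) x + leftInt μ g x := by
    rw [leftInt, leftInt, leftInt, ← intervalIntegral.integral_add]
    · congr 1; ext t; ring
    · exact (intervalIntegrable_left (hf.sub hgi) hx).continuousOn_mul (by fun_prop)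
    · exact (intervalIntegrable_left hgi hx).continuousOn_mul (by fun_prop)
  rw [hsplit]
  exact (norm_add_le _ _).trans (by linarith)

/-- Uniform Riemann–Lebesgue lemma for `rightInt`. -/
theorem rightInt_small {r : ℝ} (hr : 0 ≤ r) {f : ℝ → ℂ} (hf : IntervalIntegrable f volume 0 1)
    {ε : ℝ} (hε : 0 < ε) :
    ∃ R : ℝ, ∀ μ ∈ halfPlane r, R < ‖μ‖ → SupBound (rightInt μ f) ε := by
  obtain ⟨R, hR⟩ := leftInt_small hr (intervalIntegrable_comp_sub hf) hε
  refine ⟨R, fun μ hμ hlt => ⟨continuousOn_rightInt μ hf, fun x hx => ?_⟩⟩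
  have := (hR μ hμ hlt).le (1 - x) (one_sub_mem hx)
  rwa [leftInt_comp_sub, sub_sub_cancel] at this

/-! ### The integral system -/

/-- First component of the integral operator of the boundary value problem. -/
noncomputable def opT₁ (a c z₁ z₂ : ℝ → ℂ) (x : ℝ) : ℂ := ∫ t in (0 : ℝ)..x, c t * z₁ t + a t * z₂ t

/-- Second component of the integral operator of the boundary value problem. -/
noncomputable def opT₂ (μ : ℂ) (b d z₁ z₂ : ℝ → ℂ) (x : ℝ) : ℂ := rightInt μ (fun t => b t * z₁ t + d t * z₂ t) x

/-- Coefficients for which the square of the integral operator is a contraction. -/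
structure SmallSystem (r : ℝ) (μ : ℂ) (a b c d : ℝ → ℂ) (S δ : ℝ) : Prop where
  hr : 0 ≤ r
  hμ : μ ∈ halfPlane r
  ha : L1Bound a S
  hb : L1Bound b S
  hc : L1Bound c δ
  hd : L1Bound d δ
  hL : SupBound (leftInt μ a) δ
  hR : SupBound (rightInt μ b) δ
  small : 6 * Real.exp (2 * r) ^ 2 * ((S + δ) * δ) ≤ 1

theorem opT₁_congr {a c z₁ z₂ w₁ w₂ : ℝ → ℂ} (h₁ : ∀ x ∈ Icc (0 : ℝ) 1, z₁ x = w₁ x)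
    (h₂ : ∀ x ∈ Icc (0 : ℝ) 1, z₂ x = w₂ x) {x : ℝ} (hx : x ∈ Icc (0 : ℝ) 1) :
    opT₁ a c z₁ z₂ x = opT₁ a c w₁ w₂ x :=
  primitive_congr (fun t ht => by rw [h₁ t ht, h₂ t ht]) hx

theorem opT₂_congr {μ : ℂ} {b d z₁ z₂ w₁ w₂ : ℝ → ℂ} (h₁ : ∀ x ∈ Icc (0 : ℝ) 1, z₁ x = w₁ x)
    (h₂ : ∀ x ∈ Icc (0 : ℝ) 1, z₂ x = w₂ x) {x : ℝ} (hx : x ∈ Icc (0 : ℝ) 1) :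
    opT₂ μ b d z₁ z₂ x = opT₂ μ b d w₁ w₂ x :=
  rightInt_congr μ (fun t ht => by rw [h₁ t ht, h₂ t ht]) hx

section linearity

variable {μ : ℂ} {a b c d z₁ z₂ w₁ w₂ : ℝ → ℂ}

theorem intervalIntegrable_coeff (ha : IntervalIntegrable a volume 0 1)
    (hc : IntervalIntegrable c volume 0 1) (hz₁ : ContinuousOn z₁ (Icc 0 1))
    (hz₂ : ContinuousOn z₂ (Icc 0 1)) :
    IntervalIntegrable (fun t => c t * z₁ t + a t * z₂ t) volume 0 1 :=
  (intervalIntegrable_mul_cont hc hz₁).add (intervalIntegrable_mul_cont ha hz₂)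

theorem opT₁_add (ha : IntervalIntegrable a volume 0 1) (hc : IntervalIntegrable c volume 0 1)
    (hz₁ : ContinuousOn z₁ (Icc 0 1)) (hz₂ : ContinuousOn z₂ (Icc 0 1))
    (hw₁ : ContinuousOn w₁ (Icc 0 1)) (hw₂ : ContinuousOn w₂ (Icc 0 1)) {x : ℝ}
    (hx : x ∈ Icc (0 : ℝ) 1) :
    opT₁ a c (fun t => z₁ t + w₁ t) (fun t => z₂ t + w₂ t) x =
      opT₁ a c z₁ z₂ x + opT₁ a c w₁ w₂ x := by
  rw [opT₁, opT₁, opT₁, ← intervalIntegral.integral_add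
    (intervalIntegrable_left (intervalIntegrable_coeff ha hc hz₁ hz₂) hx)
    (intervalIntegrable_left (intervalIntegrable_coeff ha hc hw₁ hw₂) hx)]
  congr 1
  ext t
  ring

theorem opT₁_sub (ha : IntervalIntegrable a volume 0 1) (hc : IntervalIntegrable c volume 0 1)
    (hz₁ : ContinuousOn z₁ (Icc 0 1)) (hz₂ : ContinuousOn z₂ (Icc 0 1))
    (hw₁ : ContinuousOn w₁ (Icc 0 1)) (hw₂ : ContinuousOn w₂ (Icc 0 1)) {x : ℝ}
    (hx : x ∈ Icc (0 : ℝ) 1) :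
    opT₁ a c (fun t => z₁ t - w₁ t) (fun t => z₂ t - w₂ t) x =
      opT₁ a c z₁ z₂ x - opT₁ a c w₁ w₂ x := by
  rw [opT₁, opT₁, opT₁, ← intervalIntegral.integral_sub
    (intervalIntegrable_left (intervalIntegrable_coeff ha hc hz₁ hz₂) hx)
    (intervalIntegrable_left (intervalIntegrable_coeff ha hc hw₁ hw₂) hx)]
  congr 1
  ext t
  ring

theorem opT₂_add (hb : IntervalIntegrable b volume 0 1) (hd : IntervalIntegrable d volume 0 1)
    (hz₁ : ContinuousOn z₁ (Icc 0 1)) (hz₂ : ContinuousOn z₂ (Icc 0 1))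
    (hw₁ : ContinuousOn w₁ (Icc 0 1)) (hw₂ : ContinuousOn w₂ (Icc 0 1)) {x : ℝ}
    (hx : x ∈ Icc (0 : ℝ) 1) :
    opT₂ μ b d (fun t => z₁ t + w₁ t) (fun t => z₂ t + w₂ t) x =
      opT₂ μ b d z₁ z₂ x + opT₂ μ b d w₁ w₂ x := by
  rw [opT₂, opT₂, opT₂, ← rightInt_add μ (intervalIntegrable_coeff hd hb hz₁ hz₂)
    (intervalIntegrable_coeff hd hb hw₁ hw₂) hx]
  congr 1
  ext t
  ring

theorem opT₂_sub (hb : IntervalIntegrable b volume 0 1) (hd : IntervalIntegrable d volume 0 1)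
    (hz₁ : ContinuousOn z₁ (Icc 0 1)) (hz₂ : ContinuousOn z₂ (Icc 0 1))
    (hw₁ : ContinuousOn w₁ (Icc 0 1)) (hw₂ : ContinuousOn w₂ (Icc 0 1)) {x : ℝ}
    (hx : x ∈ Icc (0 : ℝ) 1) :
    opT₂ μ b d (fun t => z₁ t - w₁ t) (fun t => z₂ t - w₂ t) x =
      opT₂ μ b d z₁ z₂ x - opT₂ μ b d w₁ w₂ x := by
  rw [opT₂, opT₂, opT₂, ← rightInt_sub μ (intervalIntegrable_coeff hd hb hz₁ hz₂)
    (intervalIntegrable_coeff hd hb hw₁ hw₂) hx]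
  congr 1
  ext t
  ring

end linearity

namespace SmallSystem

variable {r : ℝ} {μ : ℂ} {a b c d z₁ z₂ : ℝ → ℂ} {S δ N : ℝ}

theorem one_le_exp (h : SmallSystem r μ a b c d S δ) : 1 ≤ Real.exp (2 * r) :=
  Real.one_le_exp (by linarith [h.hr])

theorem coeff_left (h : SmallSystem r μ a b c d S δ) (hz₁ : SupBound z₁ N) (hz₂ : SupBound z₂ N) :
    L1Bound (fun t => c t * z₁ t + a t * z₂ t) ((S + δ) * N) :=
  ((h.hc.mul hz₁).add (h.ha.mul hz₂)).mono (by linarith)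

theorem coeff_right (h : SmallSystem r μ a b c d S δ) (hz₁ : SupBound z₁ N) (hz₂ : SupBound z₂ N) :
    L1Bound (fun t => b t * z₁ t + d t * z₂ t) ((S + δ) * N) :=
  ((h.hb.mul hz₁).add (h.hd.mul hz₂)).mono (by linarith)

/-- The exponential factor is superfluous here; it is included so that both components share one
bound for the norm of `T`. -/
theorem supBound_opT₁ (h : SmallSystem r μ a b c d S δ) (hz₁ : SupBound z₁ N)
    (hz₂ : SupBound z₂ N) :
    SupBound (opT₁ a c z₁ z₂) (Real.exp (2 * r) * ((S + δ) * N)) :=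
  (h.coeff_left hz₁ hz₂).primitive.mono
    (le_mul_of_one_le_left (h.coeff_left hz₁ hz₂).nonneg h.one_le_exp)

theorem supBound_opT₂ (h : SmallSystem r μ a b c d S δ) (hz₁ : SupBound z₁ N)
    (hz₂ : SupBound z₂ N) :
    SupBound (opT₂ μ b d z₁ z₂) (Real.exp (2 * r) * ((S + δ) * N)) :=
  (h.coeff_right hz₁ hz₂).rightInt h.hr h.hμ

/-- With `q = b z₁ + d z₂`, integration by parts gives `∫ a R(q) = ∫ q L(a) + L(a) R(q)`, so every
term contains `L(a)` or `c`. The total is `(2 + E)(S + δ)δN` with `E = e^{2r}`, at most `3E²(S +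
δ)δN`; hence the 6 in `small`. -/
theorem supBound_sq₁ (h : SmallSystem r μ a b c d S δ) (hz₁ : SupBound z₁ N)
    (hz₂ : SupBound z₂ N) :
    SupBound (opT₁ a c (opT₁ a c z₁ z₂) (opT₂ μ b d z₁ z₂)) (N / 2) := by
  have hl := h.coeff_left hz₁ hz₂
  have hq := h.coeff_right hz₁ hz₂
  have h₁ := (h.hc.mul hl.primitive).primitive
  have h₂ := ((hq.mul h.hL).primitive).add (h.hL.mul (hq.rightInt h.hr h.hμ))
  refine ((h₁.add h₂).congr fun x hx => ?_).mono ?_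
  · rw [← integral_mul_rightInt μ h.ha.int hq.int hx, ← intervalIntegral.integral_add]
    · rfl
    · exact intervalIntegrable_left (h.hc.mul hl.primitive).int hx
    · exact intervalIntegrable_left (h.ha.mul (hq.rightInt h.hr h.hμ)).int hx
  · have hE := h.one_le_exp
    have hN := hz₁.nonneg
    have hS := h.ha.nonneg
    have hδ := h.hc.nonneg
    have hk : 0 ≤ (S + δ) * δ * N := by positivity
    have hs := mul_le_mul_of_nonneg_right h.small hN
    have : Real.exp (2 * r) ≤ Real.exp (2 * r) ^ 2 := le_self_pow₀ hE two_ne_zero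
    nlinarith [mul_nonneg (sub_nonneg.2 this) hk, mul_nonneg (sub_nonneg.2 hE) hk]

/-- Here `R(b ∫ ℓ) = R(b) ∫ ℓ + R(ℓ R(b))` with `ℓ = c z₁ + a z₂`, so every term contains `R(b)` or
`d`. The total is `(1 + E + E²)(S + δ)δN`. -/
theorem supBound_sq₂ (h : SmallSystem r μ a b c d S δ) (hz₁ : SupBound z₁ N)
    (hz₂ : SupBound z₂ N) :
    SupBound (opT₂ μ b d (opT₁ a c z₁ z₂) (opT₂ μ b d z₁ z₂)) (N / 2) := by
  have hl := h.coeff_left hz₁ hz₂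
  have hq := h.coeff_right hz₁ hz₂
  have h₁ := (h.hd.mul (hq.rightInt h.hr h.hμ)).rightInt h.hr h.hμ
  have h₂ := (h.hR.mul hl.primitive).add ((hl.mul h.hR).rightInt h.hr h.hμ)
  refine ((h₂.add h₁).congr fun x hx => ?_).mono ?_
  · rw [← rightInt_mul_primitive μ hl.int h.hb.int hx, ← rightInt_add μ
      (h.hb.mul hl.primitive).int (h.hd.mul (hq.rightInt h.hr h.hμ)).int hx]
    rfl
  · have hE := h.one_le_exp
    have hN := hz₁.nonneg
    have hS := h.ha.nonneg
    have hδ := h.hc.nonneg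
    have hk : 0 ≤ (S + δ) * δ * N := by positivity
    have hs := mul_le_mul_of_nonneg_right h.small hN
    have : Real.exp (2 * r) ≤ Real.exp (2 * r) ^ 2 := le_self_pow₀ hE two_ne_zero
    nlinarith [mul_nonneg (sub_nonneg.2 this) hk, mul_nonneg (sub_nonneg.2 hE) hk]

/-- A priori estimate for the integral system `z = f + T z`. -/
theorem apriori (h : SmallSystem r μ a b c d S δ) {f₁ f₂ : ℝ → ℂ} {F : ℝ}
    (hz₁ : ContinuousOn z₁ (Icc 0 1)) (hz₂ : ContinuousOn z₂ (Icc 0 1))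
    (hf₁ : SupBound f₁ F) (hf₂ : SupBound f₂ F)
    (e₁ : ∀ x ∈ Icc (0 : ℝ) 1, z₁ x = f₁ x + opT₁ a c z₁ z₂ x)
    (e₂ : ∀ x ∈ Icc (0 : ℝ) 1, z₂ x = f₂ x + opT₂ μ b d z₁ z₂ x) :
    SupBound z₁ (2 * (1 + Real.exp (2 * r) * (S + δ)) * F) ∧
      SupBound z₂ (2 * (1 + Real.exp (2 * r) * (S + δ)) * F) := by
  obtain ⟨x₀, hx₀, hmax⟩ := isCompact_Icc.exists_isMaxOn (nonempty_Icc.2 (zero_le_one (α := ℝ)))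
    (hz₁.norm.sup hz₂.norm)
  set N := ‖z₁ x₀‖ ⊔ ‖z₂ x₀‖ with hN
  have b₁ : SupBound z₁ N := ⟨hz₁, fun x hx => le_sup_left.trans (hmax hx)⟩
  have b₂ : SupBound z₂ N := ⟨hz₂, fun x hx => le_sup_right.trans (hmax hx)⟩
  -- One iteration of the equation: `z = f + T f + T² z`, with the last term at most `N / 2`, to be
  -- absorbed on the left.
  have k₁ : SupBound z₁ (F + (Real.exp (2 * r) * ((S + δ) * F) + N / 2)) := by
    refine (hf₁.add ((h.supBound_opT₁ hf₁ hf₂).add (h.supBound_sq₁ b₁ b₂))).congr fun x hx => ?_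
    rw [e₁ x hx, ← opT₁_add h.ha.int h.hc.int hf₁.cont hf₂.cont (h.supBound_opT₁ b₁ b₂).cont
      (h.supBound_opT₂ b₁ b₂).cont hx, opT₁_congr e₁ e₂ hx]
  have k₂ : SupBound z₂ (F + (Real.exp (2 * r) * ((S + δ) * F) + N / 2)) := by
    refine (hf₂.add ((h.supBound_opT₂ hf₁ hf₂).add (h.supBound_sq₂ b₁ b₂))).congr fun x hx => ?_
    rw [e₂ x hx, ← opT₂_add h.hb.int h.hd.int hf₁.cont hf₂.cont (h.supBound_opT₁ b₁ b₂).cont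
      (h.supBound_opT₂ b₁ b₂).cont hx, opT₂_congr e₁ e₂ hx]
  have hle : N ≤ F + (Real.exp (2 * r) * ((S + δ) * F) + N / 2) :=
    sup_le (k₁.le x₀ hx₀) (k₂.le x₀ hx₀)
  have hle' : N ≤ 2 * (1 + Real.exp (2 * r) * (S + δ)) * F := by linarith
  exact ⟨b₁.mono hle', b₂.mono hle'⟩

/-- The integral system `z = f + T z` is solvable. -/
theorem exists_solution (h : SmallSystem r μ a b c d S δ) {f₁ f₂ : ℝ → ℂ}
    (hf₁ : ContinuousOn f₁ (Icc 0 1)) (hf₂ : ContinuousOn f₂ (Icc 0 1)) :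
    ∃ z₁ z₂ : ℝ → ℂ, Continuous z₁ ∧ Continuous z₂ ∧
      (∀ x ∈ Icc (0 : ℝ) 1, z₁ x = f₁ x + opT₁ a c z₁ z₂ x) ∧
      ∀ x ∈ Icc (0 : ℝ) 1, z₂ x = f₂ x + opT₂ μ b d z₁ z₂ x := by
  let X := C(Icc (0 : ℝ) 1, ℂ) × C(Icc (0 : ℝ) 1, ℂ)
  -- The operators act on functions on `ℝ`, the fixed point theorem on continuous functions on
  -- `[0,1]`; constant extension beyond the endpoints links the two.
  let ext : C(Icc (0 : ℝ) 1, ℂ) → ℝ → ℂ := fun z => IccExtend zero_le_one z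
  have hext : ∀ z, Continuous (ext z) := fun z => z.continuous.Icc_extend'
  have hval : ∀ (z : C(Icc (0 : ℝ) 1, ℂ)) (x) (hx : x ∈ Icc (0 : ℝ) 1), ext z x = z ⟨x, hx⟩ :=
    fun z x hx => IccExtend_of_mem _ _ hx
  have c₁ : ∀ z : X, ContinuousOn (fun x => f₁ x + opT₁ a c (ext z.1) (ext z.2) x) (Icc 0 1) := by
    intro z
    have := intervalIntegrable_coeff h.ha.int h.hc.int (hext z.1).continuousOn
      (hext z.2).continuousOn
    exact hf₁.add (L1Bound.primitive ⟨this, le_rfl⟩).cont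
  have c₂ : ∀ z : X, ContinuousOn (fun x => f₂ x + opT₂ μ b d (ext z.1) (ext z.2) x) (Icc 0 1) := by
    intro z
    have := intervalIntegrable_coeff h.hd.int h.hb.int (hext z.1).continuousOn
      (hext z.2).continuousOn
    exact hf₂.add (continuousOn_rightInt μ this)
  let Φ : X → X := fun z => (⟨_, (c₁ z).domRestrict⟩, ⟨_, (c₂ z).domRestrict⟩)
  have v₁ : ∀ z, ∀ x ∈ Icc (0 : ℝ) 1,
      ext (Φ z).1 x = f₁ x + opT₁ a c (ext z.1) (ext z.2) x := fun z x hx => by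
    rw [hval _ x hx]; rfl
  have v₂ : ∀ z, ∀ x ∈ Icc (0 : ℝ) 1,
      ext (Φ z).2 x = f₂ x + opT₂ μ b d (ext z.1) (ext z.2) x := fun z x hx => by
    rw [hval _ x hx]; rfl
  have hlip : ∀ z w, dist (Φ (Φ z)) (Φ (Φ w)) ≤ (1 / 2) * dist z w := by
    intro z w
    have hc := fun z : C(Icc (0 : ℝ) 1, ℂ) => (hext z).continuousOn (s := Icc (0 : ℝ) 1)
    have b₁ : SupBound (fun t => ext z.1 t - ext w.1 t) (dist z w) :=
      ⟨(hc _).sub (hc _), fun x hx => by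
        rw [hval _ x hx, hval _ x hx, ← dist_eq_norm]
        exact (ContinuousMap.dist_apply_le_dist _).trans (le_max_left _ _)⟩
    have b₂ : SupBound (fun t => ext z.2 t - ext w.2 t) (dist z w) :=
      ⟨(hc _).sub (hc _), fun x hx => by
        rw [hval _ x hx, hval _ x hx, ← dist_eq_norm]
        exact (ContinuousMap.dist_apply_le_dist _).trans (le_max_right _ _)⟩
    have d₁ : ∀ x ∈ Icc (0 : ℝ) 1, ext (Φ z).1 x - ext (Φ w).1 x =
        opT₁ a c (fun t => ext z.1 t - ext w.1 t) (fun t => ext z.2 t - ext w.2 t) x :=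
      fun x hx => by
        rw [v₁ z x hx, v₁ w x hx,
          opT₁_sub h.ha.int h.hc.int (hc _) (hc _) (hc _) (hc _) hx]
        ring
    have d₂ : ∀ x ∈ Icc (0 : ℝ) 1, ext (Φ z).2 x - ext (Φ w).2 x =
        opT₂ μ b d (fun t => ext z.1 t - ext w.1 t) (fun t => ext z.2 t - ext w.2 t) x :=
      fun x hx => by
        rw [v₂ z x hx, v₂ w x hx,
          opT₂_sub h.hb.int h.hd.int (hc _) (hc _) (hc _) (hc _) hx]
        ring
    have hnn : 0 ≤ 1 / 2 * dist z w := by positivity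
    refine max_le ((ContinuousMap.dist_le hnn).2 fun x => ?_)
      ((ContinuousMap.dist_le hnn).2 fun x => ?_)
    · have := (h.supBound_sq₁ b₁ b₂).le x x.2
      rw [← opT₁_congr d₁ d₂ x.2, opT₁_sub h.ha.int h.hc.int (hc _) (hc _) (hc _) (hc _) x.2] at this
      rw [dist_eq_norm, ← hval _ x x.2, ← hval _ x x.2, v₁ _ x x.2, v₁ _ x x.2,
        add_sub_add_left_eq_sub]
      linarith
    · have := (h.supBound_sq₂ b₁ b₂).le x x.2
      rw [← opT₂_congr d₁ d₂ x.2, opT₂_sub h.hb.int h.hd.int (hc _) (hc _) (hc _) (hc _) x.2] at this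
      rw [dist_eq_norm, ← hval _ x x.2, ← hval _ x x.2, v₂ _ x x.2, v₂ _ x x.2,
        add_sub_add_left_eq_sub]
      linarith
  have hcontr : ContractingWith (1 / 2) Φ^[2] :=
    ⟨by norm_num, LipschitzWith.of_dist_le_mul fun z w => by simpa using hlip z w⟩
  set p := ContractingWith.fixedPoint Φ^[2] hcontr
  -- The unique fixed point of a contractive iterate is fixed by the map itself, since `Φ p` is
  -- again a fixed point of `Φ^[2]`.
  have hp : Φ p = p := ContractingWith.isFixedPt_fixedPoint_iterate hcontr
  refine ⟨ext p.1, ext p.2, hext _, hext _, fun x hx => ?_, fun x hx => ?_⟩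
  · rw [← v₁ p x hx, hp]
  · rw [← v₂ p x hx, hp]

end SmallSystem

/-! ### Solutions of the differential system and of the integral system -/

theorem AC_congr {f g : ℝ → ℂ} {a b : ℝ} (hf : AbsolutelyContinuousOnInterval f a b)
    (h : ∀ x ∈ uIcc a b, g x = f x) : AbsolutelyContinuousOnInterval g a b := by
  rw [absolutelyContinuousOnInterval_iff] at hf ⊢
  intro ε hε
  obtain ⟨δ, hδ, H⟩ := hf ε hε
  refine ⟨δ, hδ, fun E hE hlt => ?_⟩
  convert! H E hE hlt using 1
  refine Finset.sum_congr rfl fun i hi => ?_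
  rw [h _ (hE.1 i hi).1, h _ (hE.1 i hi).2]

theorem AC_const (k : ℂ) (a b : ℝ) : AbsolutelyContinuousOnInterval (fun _ : ℝ => k) a b :=
  (contDiff_const (n := 1)).contDiffOn.absolutelyContinuousOnInterval

theorem ae_mem_Ioo : ∀ᵐ x : ℝ, x ∈ uIcc (0 : ℝ) 1 → x ∈ Ioo (0 : ℝ) 1 := by
  have h₁ : ∀ᵐ x : ℝ, x ≠ 0 := by simp [ae_iff]
  have h₂ : ∀ᵐ x : ℝ, x ≠ 1 := by simp [ae_iff]
  filter_upwards [h₁, h₂] with x h₁ h₂ hx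
  rw [uIcc_of_le zero_le_one] at hx
  exact ⟨lt_of_le_of_ne hx.1 h₁.symm, lt_of_le_of_ne hx.2 h₂⟩

/-- Agreement on the closed interval determines two-sided derivatives only at interior points; the
endpoints form a null set. -/
theorem ae_hasDerivAt_congr {f g f' : ℝ → ℂ} (h : ∀ x ∈ Icc (0 : ℝ) 1, g x = f x)
    (hf : ∀ᵐ x, x ∈ uIcc (0 : ℝ) 1 → HasDerivAt f (f' x) x) :
    ∀ᵐ x, x ∈ uIcc (0 : ℝ) 1 → HasDerivAt g (f' x) x := by
  filter_upwards [hf, ae_mem_Ioo] with x h₁ h₂ hx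
  exact (h₁ hx).congr_of_eventuallyEq
    (Filter.eventually_of_mem (Ioo_mem_nhds (h₂ hx).1 (h₂ hx).2)
      fun y hy => h y ⟨hy.1.le, hy.2.le⟩)

theorem isSolution_iff {M : ℝ → Matrix (Fin 2) (Fin 2) ℂ} {Y : ℝ → Fin 2 → ℂ} :
    IsSolution M Y ↔ ∀ i, AbsolutelyContinuousOnInterval (fun x => Y x i) 0 1 ∧
      ∀ᵐ x, x ∈ uIcc (0 : ℝ) 1 → HasDerivAt (fun x => Y x i) ((M x *ᵥ Y x) i) x := by
  rw [IsSolution, ae_restrict_iff' measurableSet_Icc, uIcc_of_le zero_le_one, forall_and]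
  refine and_congr_right fun _ => ?_
  simp only [hasDerivAt_pi, imp_forall_iff]
  rw [ae_all_iff]

theorem IsSolution.add_smul {M : ℝ → Matrix (Fin 2) (Fin 2) ℂ} {Y Z : ℝ → Fin 2 → ℂ} (k : ℂ)
    (hY : IsSolution M Y) (hZ : IsSolution M Z) : IsSolution M (fun x => Y x + k • Z x) := by
  rw [isSolution_iff] at hY hZ ⊢
  intro i
  refine ⟨(hY i).1.fun_add ((hZ i).1.const_smul k), ?_⟩
  filter_upwards [(hY i).2, (hZ i).2] with x h₁ h₂ hx
  convert! (h₁ hx).fun_add ((h₂ hx).const_smul k) using 1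
  simp only [Matrix.mulVec_add, Matrix.mulVec_smul, Pi.add_apply, Pi.smul_apply]

/-- Two solutions with complementary boundary values form a fundamental system as soon as the
homogeneous boundary value problem has only the trivial solution. -/
theorem isFundamentalSystem_of_unique {M : ℝ → Matrix (Fin 2) (Fin 2) ℂ} {W V : ℝ → Fin 2 → ℂ}
    (hW : IsSolution M W) (hV : IsSolution M V) (hW₀ : W 0 0 = 1) (hW₁ : W 1 1 = 0)
    (hV₀ : V 0 0 = 0) (hV₁ : V 1 1 = 1)
    (huniq : ∀ X, IsSolution M X → X 0 0 = 0 → X 1 1 = 0 → ∀ x ∈ Icc (0 : ℝ) 1, X x = 0) :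
    IsFundamentalSystem M W V := by
  refine ⟨hW, hV, fun X hX => ⟨(X 0 0, X 1 1), fun x hx => ?_, fun c hc => ?_⟩⟩
  · have h := huniq _ ((hX.add_smul (-X 0 0) hW).add_smul (-X 1 1) hV) (by simp [hW₀, hV₀])
      (by simp [hW₁, hV₁]) x hx
    simp only [neg_smul] at h
    rw [← sub_eq_zero, ← h]
    abel
  · have h₀ := congrFun (hc 0 (by simp)) 0
    have h₁ := congrFun (hc 1 (by simp)) 1
    simp only [Pi.add_apply, Pi.smul_apply, smul_eq_mul, hW₀, hV₀, hW₁, hV₁, mul_one, mul_zero,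
      add_zero, zero_add] at h₀ h₁
    exact Prod.ext h₀.symm h₁.symm

/-- The coefficient matrix whose solutions `Y = e^{iμx} z` correspond to `z = f + T z`. -/
def coeffMatrix (μ : ℂ) (a b c d : ℝ → ℂ) (x : ℝ) : Matrix (Fin 2) (Fin 2) ℂ :=
  !![Complex.I * μ + c x, a x; -b x, -(Complex.I * μ) - d x]

/-- The integral equations show that `z` is absolutely continuous and satisfies `z₁' = c z₁ + a z₂`,
`z₂' = -2iμ z₂ - b z₁ - d z₂`; the factor `e^{iμx}` shifts both diagonal entries by `iμ`. -/
theorem isSolution_exp_smul {μ : ℂ} {a b c d z₁ z₂ : ℝ → ℂ} (k : ℂ)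
    (ha : IntervalIntegrable a volume 0 1) (hb : IntervalIntegrable b volume 0 1)
    (hc : IntervalIntegrable c volume 0 1) (hd : IntervalIntegrable d volume 0 1)
    (hz₁ : Continuous z₁) (hz₂ : Continuous z₂)
    (e₁ : ∀ x ∈ Icc (0 : ℝ) 1, z₁ x = k + opT₁ a c z₁ z₂ x)
    (e₂ : ∀ x ∈ Icc (0 : ℝ) 1, z₂ x = opT₂ μ b d z₁ z₂ x) :
    IsSolution (coeffMatrix μ a b c d)
      (fun x => ![Complex.exp (Complex.I * μ * x) * z₁ x, Complex.exp (Complex.I * μ * x) * z₂ x]) := by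
  have i₁ := intervalIntegrable_coeff ha hc hz₁.continuousOn hz₂.continuousOn
  have i₂ := intervalIntegrable_coeff hd hb hz₁.continuousOn hz₂.continuousOn
  have u := (uIcc_of_le (zero_le_one (α := ℝ)))
  have hexp := absolutelyContinuousOnInterval_exp (Complex.I * μ) 0 1
  rw [isSolution_iff]
  intro i
  fin_cases i
  · have hac := AC_congr ((AC_const k 0 1).fun_add
      (absolutelyContinuousOnInterval_primitive i₁ left_mem_uIcc)) (by rw [u]; exact e₁)
    have hder := ae_hasDerivAt_congr (f' := fun t => c t * z₁ t + a t * z₂ t) e₁ (by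
      filter_upwards [i₁.ae_hasDerivAt_integral] with x hx hxm
      exact (hx hxm 0 left_mem_uIcc).const_add k)
    refine ⟨hexp.fun_smul hac, ?_⟩
    filter_upwards [hder] with x hx hxm
    convert! (hasDerivAt_exp_mul (Complex.I * μ) x).fun_mul (hx hxm) using 1
    simp [coeffMatrix, Matrix.mulVec, dotProduct, Fin.sum_univ_two]
    ring
  · have hac := AC_congr (kernel_right μ i₂).1 (by rw [u]; exact e₂)
    have hder := ae_hasDerivAt_congr e₂ (kernel_right μ i₂).2
    refine ⟨hexp.fun_smul hac, ?_⟩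
    filter_upwards [hder] with x hx hxm
    have hxm' := hxm
    rw [u] at hxm'
    convert! (hasDerivAt_exp_mul (Complex.I * μ) x).fun_mul (hx hxm) using 1
    have e := e₂ x hxm'
    rw [opT₂] at e
    rw [← e]
    simp [coeffMatrix, Matrix.mulVec, dotProduct, Fin.sum_univ_two]
    ring

theorem IsSolution.continuousOn {M : ℝ → Matrix (Fin 2) (Fin 2) ℂ} {X : ℝ → Fin 2 → ℂ}
    (hX : IsSolution M X) (i : Fin 2) : ContinuousOn (fun x => X x i) (Icc 0 1) := by
  simpa [uIcc_of_le] using (hX.1 i).continuousOn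

/-- A solution with vanishing boundary data solves the homogeneous integral system. -/
theorem integral_system_of_isSolution {μ : ℂ} {a b c d : ℝ → ℂ}
    (ha : IntervalIntegrable a volume 0 1) (hb : IntervalIntegrable b volume 0 1)
    (hc : IntervalIntegrable c volume 0 1) (hd : IntervalIntegrable d volume 0 1)
    {X : ℝ → Fin 2 → ℂ} (hX : IsSolution (coeffMatrix μ a b c d) X) (h₀ : X 0 0 = 0)
    (h₁ : X 1 1 = 0) {z₁ z₂ : ℝ → ℂ}
    (hz₁ : z₁ = fun x : ℝ => Complex.exp (-(Complex.I * μ) * x) * X x 0)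
    (hz₂ : z₂ = fun x : ℝ => Complex.exp (-(Complex.I * μ) * x) * X x 1) :
    ContinuousOn z₁ (Icc 0 1) ∧ ContinuousOn z₂ (Icc 0 1) ∧
      (∀ x ∈ Icc (0 : ℝ) 1, z₁ x = opT₁ a c z₁ z₂ x) ∧
      ∀ x ∈ Icc (0 : ℝ) 1, z₂ x = opT₂ μ b d z₁ z₂ x := by
  have hexp := absolutelyContinuousOnInterval_exp (-(Complex.I * μ)) 0 1
  have hs := isSolution_iff.1 hX
  have ac₁ : AbsolutelyContinuousOnInterval z₁ 0 1 := hz₁ ▸ hexp.fun_smul (hX.1 0)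
  have ac₂ : AbsolutelyContinuousOnInterval z₂ 0 1 := hz₂ ▸ hexp.fun_smul (hX.1 1)
  have c₁ : ContinuousOn z₁ (Icc 0 1) := by simpa [uIcc_of_le] using ac₁.continuousOn
  have c₂ : ContinuousOn z₂ (Icc 0 1) := by simpa [uIcc_of_le] using ac₂.continuousOn
  have i₁ := intervalIntegrable_coeff ha hc c₁ c₂
  have i₂ := intervalIntegrable_coeff hd hb c₁ c₂
  refine ⟨c₁, c₂, fun x hx => ?_, fun x hx => ?_⟩
  · have h := AC_eq_add_integral ac₁ i₁ (x := x) (by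
      filter_upwards [(hs 0).2] with y hy hym
      have := (hasDerivAt_exp_mul (-(Complex.I * μ)) y).fun_mul (hy hym)
      rw [hz₁, hz₂]
      convert! this using 1
      simp [coeffMatrix, Matrix.mulVec, dotProduct, Fin.sum_univ_two]
      ring) (by rw [uIcc_of_le zero_le_one]; exact hx)
    rw [h]
    simp [hz₁, h₀, opT₁]
  · refine eq_rightInt ac₂ i₂ ?_ (by simp [hz₂, h₁]) hx
    filter_upwards [(hs 1).2] with y hy hym
    have := (hasDerivAt_exp_mul (-(Complex.I * μ)) y).fun_mul (hy hym)
    rw [hz₁, hz₂]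
    convert! this using 1
    simp [coeffMatrix, Matrix.mulVec, dotProduct, Fin.sum_univ_two]
    ring

/-- The a priori estimate with zero inhomogeneity. -/
theorem SmallSystem.eq_zero_of_boundary {r : ℝ} {μ : ℂ} {a b c d : ℝ → ℂ} {S δ : ℝ}
    (h : SmallSystem r μ a b c d S δ) {X : ℝ → Fin 2 → ℂ}
    (hX : IsSolution (coeffMatrix μ a b c d) X) (h₀ : X 0 0 = 0) (h₁ : X 1 1 = 0) :
    ∀ x ∈ Icc (0 : ℝ) 1, X x = 0 := by
  obtain ⟨c₁, c₂, e₁, e₂⟩ := integral_system_of_isSolution h.ha.int h.hb.int h.hc.int h.hd.int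
    hX h₀ h₁ rfl rfl
  have hz : SupBound (fun _ => (0 : ℂ)) 0 := by simpa using supBound_const 0
  obtain ⟨b₁, b₂⟩ := h.apriori c₁ c₂ hz hz (fun x hx => by rw [zero_add]; exact e₁ x hx)
    (fun x hx => by rw [zero_add]; exact e₂ x hx)
  intro x hx
  have k₁ := b₁.le x hx
  have k₂ := b₂.le x hx
  rw [mul_zero, norm_le_zero_iff, mul_eq_zero] at k₁ k₂
  ext i
  fin_cases i
  · exact k₁.resolve_left (Complex.exp_ne_zero _)
  · exact k₂.resolve_left (Complex.exp_ne_zero _)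

/-! ### Reflection `x ↦ 1 - x` -/

theorem ae_comp_one_sub {p : ℝ → Prop} (h : ∀ᵐ x, p x) : ∀ᵐ x : ℝ, p (1 - x) :=
  (Measure.measurePreserving_sub_left volume (1 : ℝ)).quasiMeasurePreserving.ae h

/-- By the fundamental theorem of calculus, `f(1 - x) = f(1) - ∫₀ˣ f'(1 - t) dt`, which is again a
primitive. -/
theorem AC_comp_one_sub {f f' : ℝ → ℂ} (hf : AbsolutelyContinuousOnInterval f 0 1)
    (hf' : IntervalIntegrable f' volume 0 1)
    (hd : ∀ᵐ x, x ∈ uIcc (0 : ℝ) 1 → HasDerivAt f (f' x) x) :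
    AbsolutelyContinuousOnInterval (fun x => f (1 - x)) 0 1 := by
  have hi := intervalIntegrable_comp_sub hf'
  refine AC_congr ((AC_const (f 1) 0 1).fun_sub
    (absolutelyContinuousOnInterval_primitive hi left_mem_uIcc)) fun x hx => ?_
  rw [uIcc_of_le zero_le_one] at hx
  have h₁ := AC_eq_add_integral hf hf' hd (x := 1) (by simp)
  have h₂ := AC_eq_add_integral hf hf' hd (x := 1 - x) (by
    rw [uIcc_of_le zero_le_one]; exact one_sub_mem hx)
  have h₃ := intervalIntegral.integral_add_adjacent_intervals
    (intervalIntegrable_left hf' (one_sub_mem hx)) (intervalIntegrable_right hf' (one_sub_mem hx))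
  have h₄ := intervalIntegral.integral_comp_sub_left (a := 0) (b := x) f' 1
  rw [sub_zero] at h₄
  rw [h₄, h₁, h₂, ← h₃]
  ring

/-- Reflection of a solution, with the two components interchanged. -/
theorem IsSolution.reflect {M M' : ℝ → Matrix (Fin 2) (Fin 2) ℂ} {Y : ℝ → Fin 2 → ℂ}
    (hM : ∀ i j, IntervalIntegrable (fun x => M x i j) volume 0 1)
    (hM' : ∀ x i j, M' x i j = -M (1 - x) (Fin.rev i) (Fin.rev j)) (hY : IsSolution M Y) :
    IsSolution M' (fun x i => Y (1 - x) (Fin.rev i)) := by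
  have hs := isSolution_iff.1 hY
  have hint : ∀ i, IntervalIntegrable (fun x => (M x *ᵥ Y x) i) volume 0 1 := by
    intro i
    have : (fun x => (M x *ᵥ Y x) i) = fun x => M x i 0 * Y x 0 + M x i 1 * Y x 1 := by
      ext x
      simp [Matrix.mulVec, dotProduct, Fin.sum_univ_two]
    rw [this]
    exact (intervalIntegrable_mul_cont (hM i 0) (hY.continuousOn 0)).add
      (intervalIntegrable_mul_cont (hM i 1) (hY.continuousOn 1))
  rw [isSolution_iff]
  intro i
  obtain ⟨hac, hder⟩ := hs (Fin.rev i)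
  have hrefl := AC_comp_one_sub hac (hint (Fin.rev i)) hder
  refine ⟨hrefl, ?_⟩
  filter_upwards [ae_comp_one_sub hder] with x hx hxm
  rw [uIcc_of_le zero_le_one] at hx hxm
  have h := (hx (one_sub_mem hxm)).comp_const_sub 1 x
  have e : (M' x *ᵥ fun i => Y (1 - x) (Fin.rev i)) i = -(M (1 - x) *ᵥ Y (1 - x)) (Fin.rev i) := by
    have r₀ : Fin.rev (0 : Fin 2) = 1 := rfl
    have r₁ : Fin.rev (1 : Fin 2) = 0 := rfl
    simp only [Matrix.mulVec, dotProduct, Fin.sum_univ_two, hM', r₀, r₁]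
    ring
  rw [e]
  exact h

/-! ### Asymptotics of the solutions of the integral systems -/

theorem opK₁_one (σ₁ σ₂ : ℝ → ℂ) (μ : ℂ) :
    opK₁ σ₁ σ₂ μ oneFun = fun x => ∫ t in (0 : ℝ)..x, σ₁ t * rightInt μ σ₂ t := by
  simp only [oneFun, mul_one, opK₁, funext_iff, implies_true]

/-- The solution of the unperturbed integral system, up to terms of second order. -/
theorem SmallSystem.unperturbed_asymptotics {r : ℝ} {μ : ℂ} {σ₁ σ₂ z₁ z₂ : ℝ → ℂ} {S δ κ G : ℝ}
    (h : SmallSystem r μ (fun x => -σ₁ x) σ₂ (fun _ => 0) (fun _ => 0) S δ)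
    (hκ : L1Bound (fun t => σ₁ t * rightInt μ σ₂ t) κ)
    (hG : L1Bound (fun t => σ₁ t * rightInt μ σ₂ t * rightInt μ σ₂ t) G)
    (hz₁ : ContinuousOn z₁ (Icc 0 1)) (hz₂ : ContinuousOn z₂ (Icc 0 1))
    (e₁ : ∀ x ∈ Icc (0 : ℝ) 1, z₁ x = 1 + opT₁ (fun x => -σ₁ x) (fun _ => 0) z₁ z₂ x)
    (e₂ : ∀ x ∈ Icc (0 : ℝ) 1, z₂ x = opT₂ μ σ₂ (fun _ => 0) z₁ z₂ x) :
    SupBound (opK₁ σ₁ σ₂ μ oneFun) κ ∧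
    SupBound (fun x => z₁ x - (1 - opK₁ σ₁ σ₂ μ oneFun x))
      (2 * (1 + Real.exp (2 * r) * (S + δ)) * (κ * κ + S * (Real.exp (2 * r) * G))) ∧
    SupBound (fun x => z₂ x - (rightInt μ σ₂ x -
        rightInt μ (fun t => σ₂ t * opK₁ σ₁ σ₂ μ oneFun t) x))
      (2 * (1 + Real.exp (2 * r) * (S + δ)) * (κ * κ + S * (Real.exp (2 * r) * G))) := by
  have hσ₁ : L1Bound σ₁ S := by simpa using h.ha.neg
  set k := opK₁ σ₁ σ₂ μ oneFun with hk_def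
  have hk_eq : ∀ x, k x = ∫ t in (0 : ℝ)..x, σ₁ t * rightInt μ σ₂ t := fun x => by
    rw [hk_def, opK₁_one]
  have hk : SupBound k κ := hκ.primitive.congr fun x _ => hk_eq x
  have hR := h.hb.rightInt h.hr h.hμ
  have hRk := (h.hb.mul hk).rightInt h.hr h.hμ
  -- This is the residual of the approximate solution. Since `k` is the primitive of `σ₁ R(σ₂)`, one
  -- has `R(σ₂ k) = R(σ₂) k + R(σ₁ R(σ₂)²)`: the first part gives `κ²`, the second `S E G`.
  have hf : SupBound (fun x => ∫ t in (0 : ℝ)..x,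
      σ₁ t * rightInt μ (fun t => σ₂ t * k t) t) (κ * κ + S * (Real.exp (2 * r) * G)) := by
    refine ((hκ.mul hk).add (hσ₁.mul (hG.rightInt h.hr h.hμ))).primitive.congr fun x hx => ?_
    refine primitive_congr (fun t ht => ?_) hx
    have := rightInt_mul_primitive μ hκ.int h.hb.int ht
    simp only [← hk_eq] at this
    rw [this]
    ring
  have hz : SupBound (fun _ => (0 : ℂ)) (κ * κ + S * (Real.exp (2 * r) * G)) :=
    ⟨continuousOn_const, fun x _ => by rw [norm_zero]; exact hf.nonneg⟩
  have hy₁ : ContinuousOn (fun x => 1 - k x) (Icc 0 1) := continuousOn_const.sub hk.cont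
  have hy₂ : ContinuousOn (fun x => rightInt μ σ₂ x - rightInt μ (fun t => σ₂ t * k t) x)
      (Icc 0 1) := hR.cont.sub hRk.cont
  refine ⟨hk, h.apriori (hz₁.sub hy₁) (hz₂.sub hy₂) hf hz (fun x hx => ?_) fun x hx => ?_⟩
  · rw [opT₁_sub h.ha.int h.hc.int hz₁ hz₂ hy₁ hy₂ hx, e₁ x hx, hk_eq x]
    have : opT₁ (fun x => -σ₁ x) (fun _ => 0) (fun x => 1 - k x)
        (fun x => rightInt μ σ₂ x - rightInt μ (fun t => σ₂ t * k t) x) x =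
        (∫ t in (0 : ℝ)..x, σ₁ t * rightInt μ (fun t => σ₂ t * k t) t) -
          ∫ t in (0 : ℝ)..x, σ₁ t * rightInt μ σ₂ t := by
      rw [opT₁, ← intervalIntegral.integral_sub (intervalIntegrable_left (hσ₁.mul hRk).int hx)
        (intervalIntegrable_left hκ.int hx)]
      congr 1
      ext t
      ring
    rw [this]
    ring
  · rw [opT₂_sub h.hb.int h.hd.int hz₁ hz₂ hy₁ hy₂ hx, e₂ x hx]
    have : opT₂ μ σ₂ (fun _ => 0) (fun x => 1 - k x)
        (fun x => rightInt μ σ₂ x - rightInt μ (fun t => σ₂ t * k t) x) x =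
        rightInt μ σ₂ x - rightInt μ (fun t => σ₂ t * k t) x := by
      rw [opT₂, ← rightInt_sub μ h.hb.int (h.hb.mul hk).int hx]
      congr 1
      ext t
      ring
    rw [this]
    ring

/-- The difference of the perturbed and the unperturbed solution, up to terms of second order. -/
theorem SmallSystem.perturbed_asymptotics {r : ℝ} {μ : ℂ}
    {σ₁ σ₂ p₁₁ p₁₂ p₂₁ p₂₂ z₁ z₂ w₁ w₂ v₁ v₂ : ℝ → ℂ} {S₀ S δ κ K Q : ℝ}
    (h : SmallSystem r μ (fun x => -σ₁ x + μ⁻¹ * p₁₂ x) (fun x => σ₂ x - μ⁻¹ * p₂₁ x)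
      (fun x => μ⁻¹ * p₁₁ x) (fun x => -(μ⁻¹ * p₂₂ x)) S δ)
    (hσ₁ : L1Bound σ₁ S₀) (hσ₂ : L1Bound σ₂ S₀) (h₁₁ : L1Bound p₁₁ S₀) (h₁₂ : L1Bound p₁₂ S₀)
    (h₂₁ : L1Bound p₂₁ S₀) (h₂₂ : L1Bound p₂₂ S₀)
    (hκ₁ : L1Bound (fun t => σ₁ t * rightInt μ σ₂ t) κ)
    (hκ₂ : L1Bound (fun t => σ₂ t * leftInt μ σ₁ t) κ)
    (hK₁₁ : L1Bound (fun t => p₁₁ t * rightInt μ σ₂ t) K)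
    (hK₁₂ : L1Bound (fun t => p₁₂ t * rightInt μ σ₂ t) K)
    (hK₂₂ : L1Bound (fun t => p₂₂ t * rightInt μ σ₂ t) K)
    (hK₂₁ : L1Bound (fun t => p₂₁ t * leftInt μ σ₁ t) K)
    (hz₁ : ContinuousOn z₁ (Icc 0 1)) (hz₂ : ContinuousOn z₂ (Icc 0 1))
    (e₁ : ∀ x ∈ Icc (0 : ℝ) 1, z₁ x = 1 + opT₁ (fun x => -σ₁ x) (fun _ => 0) z₁ z₂ x)
    (e₂ : ∀ x ∈ Icc (0 : ℝ) 1, z₂ x = opT₂ μ σ₂ (fun _ => 0) z₁ z₂ x)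
    (hq₁ : SupBound (fun x => z₁ x - 1) Q)
    (hq₂ : SupBound (fun x => z₂ x - rightInt μ σ₂ x) Q)
    (hw₁ : ContinuousOn w₁ (Icc 0 1)) (hw₂ : ContinuousOn w₂ (Icc 0 1))
    (e₁' : ∀ x ∈ Icc (0 : ℝ) 1,
      w₁ x = 1 + opT₁ (fun x => -σ₁ x + μ⁻¹ * p₁₂ x) (fun x => μ⁻¹ * p₁₁ x) w₁ w₂ x)
    (e₂' : ∀ x ∈ Icc (0 : ℝ) 1,
      w₂ x = opT₂ μ (fun x => σ₂ x - μ⁻¹ * p₂₁ x) (fun x => -(μ⁻¹ * p₂₂ x)) w₁ w₂ x)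
    (hv₁ : v₁ = fun x => μ⁻¹ * (leftInt μ σ₁ x * rightInt μ p₂₁ x + ∫ t in (0 : ℝ)..x, p₁₁ t))
    (hv₂ : v₂ = fun x => μ⁻¹ * (-rightInt μ p₂₁ x + rightInt μ σ₂ x * ∫ t in (0 : ℝ)..x, p₁₁ t))
    {E m B F : ℝ} (hE : E = Real.exp (2 * r)) (hm : m = ‖μ⁻¹‖)
    (hB : B = E * S₀ * (E * S₀) + S₀ + E * S₀ + E * S₀ * S₀)
    (hF : F = E * (m * (2 * S₀ * Q + 2 * K + 2 * S₀ * (m * B) + (1 + E) * S₀ * κ))) :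
    SupBound (fun x => w₁ x - z₁ x - v₁ x) (2 * (1 + E * (S + δ)) * F) ∧
    SupBound (fun x => w₂ x - z₂ x - v₂ x) (2 * (1 + E * (S + δ)) * F) := by
  have hr := h.hr
  have hμ := h.hμ
  have hE1 : 1 ≤ E := hE ▸ h.one_le_exp
  have hm0 : 0 ≤ m := hm ▸ norm_nonneg _
  have hS0 := hσ₁.nonneg
  have hκ0 := hκ₁.nonneg
  have hK0 := hK₁₁.nonneg
  have hQ0 := hq₁.nonneg
  have g₁ := hσ₁.leftInt hr hμ
  have g₂ := hσ₂.rightInt hr hμ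
  have hh := h₂₁.rightInt hr hμ
  have hA := h₁₁.primitive
  have b₁ : SupBound v₁ (m * B) := by
    rw [hv₁]
    refine (((g₁.mul hh).add hA).const_mul μ⁻¹).mono ?_
    rw [← hm, ← hE, hB]
    refine mul_le_mul_of_nonneg_left ?_ hm0
    have : 0 ≤ E * S₀ + E * S₀ * S₀ := by positivity
    linarith
  have b₂ : SupBound v₂ (m * B) := by
    rw [hv₂]
    refine ((hh.neg.add (g₂.mul hA)).const_mul μ⁻¹).mono ?_
    rw [← hm, ← hE, hB]
    refine mul_le_mul_of_nonneg_left ?_ hm0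
    have : 0 ≤ E * S₀ * (E * S₀) + S₀ := by positivity
    linarith
  -- The integrand of the first residual component `(T' - T) z + T' v - v`, with `T'` the perturbed
  -- operator. The terms linear in `p` without a small factor have cancelled against `v`; what
  -- remains carries `μ⁻¹` and one of `Q`, `K`, `m B`, `κ`.
  have c₁ : L1Bound (fun t => μ⁻¹ * (p₁₁ t * (z₁ t - 1) + (p₁₂ t * rightInt μ σ₂ t +
      p₁₂ t * (z₂ t - rightInt μ σ₂ t)) + (p₁₁ t * v₁ t + p₁₂ t * v₂ t) + p₂₁ t * leftInt μ σ₁ t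
      - σ₁ t * rightInt μ σ₂ t * ∫ s in (0 : ℝ)..t, p₁₁ s)) (F / E) := by
    refine ((((((h₁₁.mul hq₁).add (hK₁₂.add (h₁₂.mul hq₂))).add
      ((h₁₁.mul b₁).add (h₁₂.mul b₂))).add hK₂₁).sub (hκ₁.mul hA)).const_mul μ⁻¹).mono ?_
    rw [← hm, hF, mul_div_cancel_left₀ _ (by positivity)]
    refine mul_le_mul_of_nonneg_left ?_ hm0
    have : 0 ≤ E * S₀ * κ := by positivity
    linarith
  have c₂ : L1Bound (fun t => μ⁻¹ * (-(p₂₁ t * (z₁ t - 1)) - (p₂₂ t * rightInt μ σ₂ t +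
      p₂₂ t * (z₂ t - rightInt μ σ₂ t)) - (p₂₁ t * v₁ t + p₂₂ t * v₂ t) +
      σ₂ t * leftInt μ σ₁ t * rightInt μ p₂₁ t + p₁₁ t * rightInt μ σ₂ t)) (F / E) := by
    refine ((((((h₂₁.mul hq₁).neg.sub (hK₂₂.add (h₂₂.mul hq₂))).sub
      ((h₂₁.mul b₁).add (h₂₂.mul b₂))).add (hκ₂.mul hh)).add hK₁₁).const_mul μ⁻¹).mono ?_
    rw [← hm, hF, mul_div_cancel_left₀ _ (by positivity), ← hE]
    refine mul_le_mul_of_nonneg_left ?_ hm0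
    have : 0 ≤ S₀ * κ := by positivity
    linarith
  have hFE : E * (F / E) = F := mul_div_cancel₀ _ (by positivity)
  have f₁ := c₁.primitive.mono ((le_mul_of_one_le_left c₁.nonneg hE1).trans_eq hFE)
  have f₂ := (c₂.rightInt hr hμ).mono (by rw [← hE, hFE])
  -- Integration by parts puts `v` itself into the form of an integral operator, so that the
  -- residual can be compared integrand by integrand.
  have ψ₁ : ∀ x ∈ Icc (0 : ℝ) 1, v₁ x = ∫ t in (0 : ℝ)..x,
      μ⁻¹ * (σ₁ t * rightInt μ p₂₁ t - p₂₁ t * leftInt μ σ₁ t + p₁₁ t) := by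
    intro x hx
    rw [hv₁, intervalIntegral.integral_const_mul, intervalIntegral.integral_add
      (intervalIntegrable_left ((hσ₁.mul hh).sub hK₂₁).int hx) (intervalIntegrable_left h₁₁.int hx),
      intervalIntegral.integral_sub (intervalIntegrable_left (hσ₁.mul hh).int hx)
      (intervalIntegrable_left hK₂₁.int hx), integral_mul_rightInt μ hσ₁.int h₂₁.int hx]
    ring
  have i₁ : IntervalIntegrable (fun t => μ⁻¹ * (σ₁ t * rightInt μ p₂₁ t -
      p₂₁ t * leftInt μ σ₁ t + p₁₁ t)) volume 0 1 :=
    ((((hσ₁.mul hh).sub hK₂₁).add h₁₁).const_mul μ⁻¹).int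
  have ψ₂ : ∀ x ∈ Icc (0 : ℝ) 1, v₂ x = rightInt μ (fun t =>
      μ⁻¹ * (-p₂₁ t + (σ₂ t * ∫ s in (0 : ℝ)..t, p₁₁ s) - p₁₁ t * rightInt μ σ₂ t)) x := by
    intro x hx
    rw [hv₂, rightInt_const_mul, rightInt_sub μ (h₂₁.neg.add (hσ₂.mul hA)).int hK₁₁.int hx,
      rightInt_add μ h₂₁.neg.int (hσ₂.mul hA).int hx, rightInt_neg,
      rightInt_mul_primitive μ h₁₁.int hσ₂.int hx]
    ring
  have i₂ : IntervalIntegrable (fun t => μ⁻¹ * (-p₂₁ t + (σ₂ t * ∫ s in (0 : ℝ)..t, p₁₁ s) -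
      p₁₁ t * rightInt μ σ₂ t)) volume 0 1 :=
    (((h₂₁.neg.add (hσ₂.mul hA)).sub hK₁₁).const_mul μ⁻¹).int
  have hzero : IntervalIntegrable (fun _ : ℝ => (0 : ℂ)) volume 0 1 := by simp
  have u₁ : ContinuousOn (fun x => w₁ x - z₁ x) (Icc 0 1) := hw₁.sub hz₁
  have u₂ : ContinuousOn (fun x => w₂ x - z₂ x) (Icc 0 1) := hw₂.sub hz₂
  rw [hE]
  refine h.apriori (u₁.sub b₁.cont) (u₂.sub b₂.cont) f₁ f₂ (fun x hx => ?_) fun x hx => ?_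
  · have I₁ := intervalIntegrable_left (intervalIntegrable_coeff h.ha.int h.hc.int hz₁ hz₂) hx
    have I₂ := intervalIntegrable_left (intervalIntegrable_coeff hσ₁.neg.int hzero hz₁ hz₂) hx
    have I₃ := intervalIntegrable_left
      (intervalIntegrable_coeff h.ha.int h.hc.int b₁.cont b₂.cont) hx
    rw [opT₁_sub h.ha.int h.hc.int u₁ u₂ b₁.cont b₂.cont hx,
      opT₁_sub h.ha.int h.hc.int hw₁ hw₂ hz₁ hz₂ hx, e₁ x hx, e₁' x hx, ψ₁ x hx]
    have key := intervalIntegral.integral_sub (((I₁.sub I₂).add I₃)) (intervalIntegrable_left i₁ hx)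
    rw [intervalIntegral.integral_add (I₁.sub I₂) I₃, intervalIntegral.integral_sub I₁ I₂] at key
    simp only [opT₁]
    refine Eq.trans ?_ (congrArg (· + _) (key.symm.trans ?_))
    · ring
    · congr 1
      ext t
      simp only [hv₁, hv₂]
      ring
  · have I₁ := intervalIntegrable_coeff h.hd.int h.hb.int hz₁ hz₂
    have I₂ := intervalIntegrable_coeff hzero hσ₂.int hz₁ hz₂
    have I₃ := intervalIntegrable_coeff h.hd.int h.hb.int b₁.cont b₂.cont
    rw [opT₂_sub h.hb.int h.hd.int u₁ u₂ b₁.cont b₂.cont hx,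
      opT₂_sub h.hb.int h.hd.int hw₁ hw₂ hz₁ hz₂ hx, e₂ x hx, e₂' x hx, ψ₂ x hx]
    have key := rightInt_sub μ ((I₁.sub I₂).add I₃) i₂ hx
    rw [rightInt_add μ (I₁.sub I₂) I₃ hx, rightInt_sub μ I₁ I₂ hx] at key
    simp only [opT₂]
    refine Eq.trans ?_ (congrArg (· + _) (key.symm.trans ?_))
    · ring
    · congr 1
      ext t
      simp only [hv₁, hv₂]
      ring

/-! ### Large spectral parameters -/

/-- For large `|μ|` in the half-plane the square of the integral operator is a contraction. -/
theorem eventually_smallSystem {r : ℝ} (hr : 0 ≤ r) {σ₁ σ₂ p₁₁ p₁₂ p₂₁ p₂₂ : ℝ → ℂ} {S : ℝ}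
    (hσ₁ : L1Bound σ₁ S) (hσ₂ : L1Bound σ₂ S) (h₁₁ : L1Bound p₁₁ S) (h₁₂ : L1Bound p₁₂ S)
    (h₂₁ : L1Bound p₂₁ S) (h₂₂ : L1Bound p₂₂ S) {δ : ℝ} (hδ : 0 < δ)
    (hsmall : 6 * Real.exp (2 * r) ^ 2 * ((2 * S + δ) * δ) ≤ 1) :
    ∃ R : ℝ, ∀ μ ∈ halfPlane r, R < ‖μ‖ →
      SmallSystem r μ (fun x => -σ₁ x + μ⁻¹ * p₁₂ x) (fun x => σ₂ x - μ⁻¹ * p₂₁ x)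
        (fun x => μ⁻¹ * p₁₁ x) (fun x => -(μ⁻¹ * p₂₂ x)) (2 * S) δ := by
  obtain ⟨R₁, hR₁⟩ := leftInt_small hr hσ₁.neg.int (half_pos hδ)
  obtain ⟨R₂, hR₂⟩ := rightInt_small hr hσ₂.int (half_pos hδ)
  have hS := hσ₁.nonneg
  set E := Real.exp (2 * r) with hE
  have hE1 : 1 ≤ E := Real.one_le_exp (by linarith)
  -- Half of `δ` is allotted to `L(σ₁)` and `R(σ₂)`, half to the `μ⁻¹` perturbation via `E * S / (δ
  -- / 2)`; `‖μ‖ > 1` keeps the `L¹` norms below `2 * S`.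
  refine ⟨max (max R₁ R₂) (max 1 (E * S / (δ / 2))), fun μ hμ hlt => ?_⟩
  rw [max_lt_iff, max_lt_iff, max_lt_iff] at hlt
  obtain ⟨⟨hlt₁, hlt₂⟩, hlt₃, hlt₄⟩ := hlt
  have hμ0 : 0 < ‖μ‖ := one_pos.trans hlt₃
  have hm1 : ‖μ⁻¹‖ ≤ 1 := by rw [norm_inv]; exact inv_le_one_of_one_le₀ hlt₃.le
  have hmE : ‖μ⁻¹‖ * (E * S) ≤ δ / 2 := by
    rw [norm_inv, inv_mul_le_iff₀ hμ0]
    exact ((div_lt_iff₀ (half_pos hδ)).1 hlt₄).le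
  have hmS : ‖μ⁻¹‖ * S ≤ δ / 2 :=
    (mul_le_mul_of_nonneg_left (le_mul_of_one_le_left hS hE1) (norm_nonneg _)).trans hmE
  have hmS' : ‖μ⁻¹‖ * S ≤ S := mul_le_of_le_one_left hS hm1
  refine ⟨hr, hμ, (hσ₁.neg.add (h₁₂.const_mul _)).mono (by linarith),
    (hσ₂.sub (h₂₁.const_mul _)).mono (by linarith), (h₁₁.const_mul _).mono (by linarith),
    (h₂₂.const_mul _).neg.mono (by linarith), ?_, ?_, hsmall⟩
  · refine (((hR₁ μ hμ hlt₁).add ((h₁₂.leftInt hr hμ).const_mul μ⁻¹)).congr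
      fun x hx => ?_).mono (by linarith)
    have := rightInt_add μ hσ₁.neg.comp_sub.int (h₁₂.const_mul μ⁻¹).comp_sub.int (one_sub_mem hx)
    rw [rightInt_comp_sub μ (fun t => -σ₁ t), rightInt_comp_sub μ (fun t => μ⁻¹ * p₁₂ t),
      rightInt_comp_sub μ (fun t => -σ₁ t + μ⁻¹ * p₁₂ t), sub_sub_cancel] at this
    rw [this]
    congr 1
    have := rightInt_const_mul μ μ⁻¹ (fun t => p₁₂ (1 - t)) (1 - x)
    rwa [rightInt_comp_sub μ (fun t => μ⁻¹ * p₁₂ t), rightInt_comp_sub, sub_sub_cancel] at this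
  · refine (((hR₂ μ hμ hlt₂).sub ((h₂₁.rightInt hr hμ).const_mul μ⁻¹)).congr
      fun x hx => ?_).mono (by linarith)
    rw [rightInt_sub μ hσ₂.int (h₂₁.const_mul μ⁻¹).int hx, rightInt_const_mul]

/-- Cauchy–Schwarz inequality with respect to the weight `|σ|`. -/
theorem L1Bound.mul_sqrt {σ g : ℝ → ℂ} {S G : ℝ} (hS : 0 < S) (hσ : L1Bound σ S)
    (hg : ContinuousOn g (Icc 0 1)) (hG : ∫ t in (0 : ℝ)..1, ‖σ t‖ * ‖g t‖ ^ 2 ≤ G) :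
    L1Bound (fun t => σ t * g t) (Real.sqrt (S * G)) := by
  have hg' : ContinuousOn g (uIcc 0 1) := by rwa [uIcc_of_le zero_le_one]
  refine ⟨intervalIntegrable_mul_cont hσ.int hg, ?_⟩
  simp only [norm_mul]
  set κ := ∫ t in (0 : ℝ)..1, ‖σ t‖ * ‖g t‖
  have i₁ : IntervalIntegrable (fun t => ‖σ t‖ * ‖g t‖) volume 0 1 :=
    hσ.int.norm.mul_continuousOn hg'.norm
  have i₂ : IntervalIntegrable (fun t => ‖σ t‖ * ‖g t‖ ^ 2) volume 0 1 :=
    hσ.int.norm.mul_continuousOn (hg'.norm.pow 2)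
  -- Integrate `|σ| (S|g| - κ)² ≥ 0`; with `∫ |σ| ≤ S` this yields `S κ² ≤ S² G`.
  have key : 2 * S * κ * κ ≤ S ^ 2 * G + κ ^ 2 * S := by
    calc 2 * S * κ * κ = ∫ t in (0 : ℝ)..1, 2 * S * κ * (‖σ t‖ * ‖g t‖) := by
          rw [intervalIntegral.integral_const_mul]
      _ ≤ ∫ t in (0 : ℝ)..1, (S ^ 2 * (‖σ t‖ * ‖g t‖ ^ 2) + κ ^ 2 * ‖σ t‖) := by
          refine intervalIntegral.integral_mono_on zero_le_one (i₁.const_mul _)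
            ((i₂.const_mul _).add (hσ.int.norm.const_mul _)) fun t _ => ?_
          nlinarith [mul_nonneg (norm_nonneg (σ t)) (sq_nonneg (S * ‖g t‖ - κ))]
      _ ≤ _ := by
          rw [intervalIntegral.integral_add (i₂.const_mul _) (hσ.int.norm.const_mul _),
            intervalIntegral.integral_const_mul, intervalIntegral.integral_const_mul]
          exact add_le_add (mul_le_mul_of_nonneg_left hG (sq_nonneg _))
            (mul_le_mul_of_nonneg_left hσ.le (sq_nonneg _))
  refine Real.le_sqrt_of_sq_le (le_of_mul_le_mul_left ?_ hS)
  linarith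

/-! ### The two Dirac systems in common form, and the matrix norm in `kP`. -/

theorem perturbedMatrix_eq (σ₁ σ₂ : ℝ → ℂ) (P : ℝ → Matrix (Fin 2) (Fin 2) ℂ) (μ : ℂ) :
    perturbedMatrix σ₁ σ₂ P μ = coeffMatrix μ (fun x => -σ₁ x + μ⁻¹ * P x 0 1)
      (fun x => σ₂ x - μ⁻¹ * P x 1 0) (fun x => μ⁻¹ * P x 0 0) (fun x => -(μ⁻¹ * P x 1 1)) := by
  ext x i j
  fin_cases i <;> fin_cases j <;> simp [perturbedMatrix, coeffMatrix, matA, matJ] <;> ring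

theorem diracMatrix_eq (σ₁ σ₂ : ℝ → ℂ) (μ : ℂ) :
    diracMatrix σ₁ σ₂ μ = coeffMatrix μ (fun x => -σ₁ x) σ₂ (fun _ => 0) (fun _ => 0) := by
  ext x i j
  fin_cases i <;> fin_cases j <;> simp [diracMatrix, coeffMatrix, matA, matJ]

section matrixNorm

open scoped Matrix.Norms.Elementwise

/-- The explicit maximum gives integrability of `‖P‖` from that of the entries, and invariance under
permuting them. -/
theorem norm_fin_two (A : Matrix (Fin 2) (Fin 2) ℂ) :
    ‖A‖ = max (max ‖A 0 0‖ ‖A 0 1‖) (max ‖A 1 0‖ ‖A 1 1‖) := by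
  refine le_antisymm ((Matrix.norm_le_iff (by positivity)).2 fun i j => ?_) ?_
  · fin_cases i <;> fin_cases j <;> simp
  · simp only [max_le_iff]
    exact ⟨⟨Matrix.norm_entry_le_entrywise_sup_norm A, Matrix.norm_entry_le_entrywise_sup_norm A⟩,
      Matrix.norm_entry_le_entrywise_sup_norm A, Matrix.norm_entry_le_entrywise_sup_norm A⟩

theorem L1Bound.entry_mul_kP {σ₁ σ₂ : ℝ → ℂ} {P : ℝ → Matrix (Fin 2) (Fin 2) ℂ} {μ : ℂ}
    (hσ₁ : IntervalIntegrable σ₁ volume 0 1) (hσ₂ : IntervalIntegrable σ₂ volume 0 1)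
    (hP : ∀ i j, IntervalIntegrable (fun x => P x i j) volume 0 1) (i j : Fin 2) {g : ℝ → ℂ}
    (hg : ContinuousOn g (Icc 0 1)) (hle : ∀ x, ‖g x‖ ≤ gamma₀₁ σ₁ x μ + gamma₀₂ σ₂ x μ) :
    L1Bound (fun x => P x i j * g x) (kP σ₁ σ₂ P μ) := by
  have hN : IntervalIntegrable (fun t => ‖P t‖) volume 0 1 := by
    simp only [norm_fin_two]
    have h := fun i j => (hP i j).norm
    exact ⟨((h 0 0).1.sup (h 0 1).1).sup ((h 1 0).1.sup (h 1 1).1),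
      ((h 0 0).2.sup (h 0 1).2).sup ((h 1 0).2.sup (h 1 1).2)⟩
  refine L1Bound.of_le (intervalIntegrable_mul_cont (hP i j) hg) (hN.mul_continuousOn ?_)
    fun x _ => ?_
  · rw [uIcc_of_le zero_le_one]
    exact (continuousOn_leftInt μ hσ₁).norm.add (continuousOn_rightInt μ hσ₂).norm
  · rw [norm_mul]
    exact mul_le_mul (Matrix.norm_entry_le_entrywise_sup_norm _) (hle x) (norm_nonneg _)
      (norm_nonneg _)

/-- Invariance of `kP` under the reflection `x ↦ 1 - x`. -/
theorem kP_reflect (σ₁ σ₂ : ℝ → ℂ) (P : ℝ → Matrix (Fin 2) (Fin 2) ℂ) (μ : ℂ) :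
    kP (fun x => -σ₂ (1 - x)) (fun x => -σ₁ (1 - x))
      (fun x => -(P (1 - x)).submatrix Fin.rev Fin.rev) μ = kP σ₁ σ₂ P μ := by
  rw [kP, kP, ← integral_comp_one_sub]
  congr 1
  ext t
  have r₀ : Fin.rev (0 : Fin 2) = 1 := rfl
  have r₁ : Fin.rev (1 : Fin 2) = 0 := rfl
  have hn : ‖-(P t).submatrix Fin.rev Fin.rev‖ = ‖P t‖ := by
    rw [norm_neg, norm_fin_two, norm_fin_two]
    simp only [Matrix.submatrix_apply, r₀, r₁]
    rw [max_comm, max_comm ‖P t 1 1‖, max_comm ‖P t 0 1‖]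
  rw [sub_sub_cancel, hn, gamma₀₁, gamma₀₂, gamma₀₁, gamma₀₂, leftInt_neg, rightInt_neg,
    leftInt_comp_sub, rightInt_comp_sub, norm_neg, norm_neg, sub_sub_cancel, add_comm]

end matrixNorm

/-- Invariance of `gammaTilde` under the reflection `x ↦ 1 - x`. -/
theorem gammaTilde_reflect (σ₁ σ₂ : ℝ → ℂ) (μ : ℂ) :
    gammaTilde (fun x => -σ₂ (1 - x)) (fun x => -σ₁ (1 - x)) μ = gammaTilde σ₁ σ₂ μ := by
  rw [gammaTilde, gammaTilde, add_comm]
  congr 1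
  · rw [← integral_comp_one_sub]
    congr 1
    ext t
    rw [gamma₀₁, gamma₀₂, rightInt_neg, rightInt_comp_sub, norm_neg, norm_neg, sub_sub_cancel]
  · rw [← integral_comp_one_sub]
    congr 1
    ext t
    rw [gamma₀₁, gamma₀₂, leftInt_neg, leftInt_comp_sub, norm_neg, norm_neg, sub_sub_cancel]

/-- The part of `rho` which dominates the remainder. -/
noncomputable def rhoCore (σ₁ σ₂ : ℝ → ℂ) (P : ℝ → Matrix (Fin 2) (Fin 2) ℂ) (μ : ℂ) : ℝ :=
  ‖μ‖⁻¹ * kP σ₁ σ₂ P μ + gammaTilde σ₁ σ₂ μ + (‖μ‖ ^ 2)⁻¹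

theorem rhoCore_le_rho (q : ℝ≥0∞) (σ₁ σ₂ : ℝ → ℂ) (P : ℝ → Matrix (Fin 2) (Fin 2) ℂ) (μ : ℂ) :
    rhoCore σ₁ σ₂ P μ ≤ rho q σ₁ σ₂ P μ := by
  rw [rhoCore, rho]
  linarith [sq_nonneg (gamma₁ q σ₁ μ), sq_nonneg (gamma₂ q σ₂ μ)]

/-- After inserting `Q`, the bound `F` is a combination of `m G`, `m κ`, `m K` and `m²`. Only `m κ`
needs an idea: it is at most `m² + κ² = m² + S G`. -/
theorem remainder_le {E S A B m K G κ Q F : ℝ} (hE : 0 ≤ E) (hS : 0 ≤ S) (hA : 0 ≤ A)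
    (hB : 0 ≤ B) (hm : 0 ≤ m) (hm1 : m ≤ 1) (hK : 0 ≤ K) (hG : 0 ≤ G) (hκG : κ * κ = S * G)
    (hQ : Q = A * (κ * κ + 2 * S * (E * G)) + (1 + 2 * E * S) * κ)
    (hF : F = E * (m * (2 * S * Q + 2 * K + 2 * S * (m * B) + (1 + E) * S * κ))) :
    F ≤ E * (2 * S * (A * (S + 2 * S * E)) + (2 * S * (1 + 2 * E * S) + (1 + E) * S) * (1 + S)
      + 2 + 2 * S * B) * (m * K + G + m ^ 2) := by
  have h₁ : m * κ ≤ m ^ 2 + S * G := by nlinarith [sq_nonneg (m - κ), sq_nonneg m, sq_nonneg κ]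
  have h₂ : m * G ≤ G := mul_le_of_le_one_left hG hm1
  have hmK : 0 ≤ m * K := by positivity
  have hm2 : 0 ≤ m ^ 2 := by positivity
  set c₁ := 2 * S * (A * (S + 2 * S * E))
  set c₂ := 2 * S * (1 + 2 * E * S) + (1 + E) * S
  have hc₁ : 0 ≤ c₁ := by positivity
  have hc₂ : 0 ≤ c₂ := by positivity
  have hc₃ : 0 ≤ 2 * S * B := by positivity
  have e : F = E * (c₁ * (m * G) + c₂ * (m * κ) + 2 * (m * K) + 2 * S * B * m ^ 2) := by
    rw [hF, hQ, hκG]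
    ring
  rw [e, mul_assoc E]
  refine mul_le_mul_of_nonneg_left ?_ hE
  have k₁ := mul_le_mul_of_nonneg_left h₂ hc₁
  have k₂ := mul_le_mul_of_nonneg_left h₁ hc₂
  have n₁ := mul_nonneg hc₁ hmK
  have n₂ := mul_nonneg hc₁ hm2
  have n₃ := mul_nonneg hc₂ hmK
  have n₄ := mul_nonneg hc₂ hG
  have n₅ := mul_nonneg hc₃ hmK
  have n₆ := mul_nonneg hc₃ hG
  have n₇ := mul_nonneg (mul_nonneg hc₂ hS) hmK
  have n₈ := mul_nonneg (mul_nonneg hc₂ hS) hm2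
  nlinarith

/-- Existence, uniqueness and asymptotics of the solutions normalised by `w₁(0) = 1`,
`w₂(1) = 0`. -/
theorem exists_normalised_solutions {r : ℝ} (hr : 0 ≤ r) {σ₁ σ₂ : ℝ → ℂ}
    (hσ₁ : IntervalIntegrable σ₁ volume 0 1) (hσ₂ : IntervalIntegrable σ₂ volume 0 1)
    {P : ℝ → Matrix (Fin 2) (Fin 2) ℂ}
    (hP : ∀ i j, IntervalIntegrable (fun x => P x i j) volume 0 1) :
    ∃ R C : ℝ, 0 < R ∧ 0 < C ∧ ∀ μ ∈ halfPlane r, R < ‖μ‖ → ∃ W W' : ℝ → Fin 2 → ℂ,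
      IsSolution (diracMatrix σ₁ σ₂ μ) W ∧ W 0 0 = 1 ∧ W 1 1 = 0 ∧
      IsSolution (perturbedMatrix σ₁ σ₂ P μ) W' ∧ W' 0 0 = 1 ∧ W' 1 1 = 0 ∧
      (∀ X, IsSolution (diracMatrix σ₁ σ₂ μ) X → X 0 0 = 0 → X 1 1 = 0 →
        ∀ x ∈ Icc (0 : ℝ) 1, X x = 0) ∧
      (∀ X, IsSolution (perturbedMatrix σ₁ σ₂ P μ) X → X 0 0 = 0 → X 1 1 = 0 →
        ∀ x ∈ Icc (0 : ℝ) 1, X x = 0) ∧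
      ∀ x ∈ Icc (0 : ℝ) 1,
        ‖W' x 0 - W x 0 - Complex.exp (Complex.I * μ * x) / μ *
            (leftInt μ σ₁ x * rightInt μ (fun t => P t 1 0) x + ∫ t in (0 : ℝ)..x, P t 0 0)‖
          ≤ C * ‖Complex.exp (Complex.I * μ * x)‖ * rhoCore σ₁ σ₂ P μ ∧
        ‖W' x 1 - W x 1 - Complex.exp (Complex.I * μ * x) / μ *
            (-rightInt μ (fun t => P t 1 0) x + rightInt μ σ₂ x * ∫ t in (0 : ℝ)..x, P t 0 0)‖
          ≤ C * ‖Complex.exp (Complex.I * μ * x)‖ * rhoCore σ₁ σ₂ P μ ∧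
        ‖W x 0 - Complex.exp (Complex.I * μ * x) * (1 - opK₁ σ₁ σ₂ μ oneFun x)‖
          ≤ C * ‖Complex.exp (Complex.I * μ * x)‖ * gammaTilde σ₁ σ₂ μ ∧
        ‖W x 1 - Complex.exp (Complex.I * μ * x) *
            (rightInt μ σ₂ x - rightInt μ (fun t => σ₂ t * opK₁ σ₁ σ₂ μ oneFun t) x)‖
          ≤ C * ‖Complex.exp (Complex.I * μ * x)‖ * gammaTilde σ₁ σ₂ μ := by
  set E := Real.exp (2 * r) with hE
  have hE1 : 1 ≤ E := Real.one_le_exp (by linarith)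
  have hE0 : 0 ≤ E := by linarith
  have hex : ∃ S : ℝ, 1 ≤ S ∧ L1Bound σ₁ S ∧ L1Bound σ₂ S ∧
      ∀ i j, L1Bound (fun x => P x i j) S := by
    let n : (ℝ → ℂ) → ℝ := fun f => ∫ t in (0 : ℝ)..1, ‖f t‖
    have hn : ∀ f, 0 ≤ n f := fun f =>
      intervalIntegral.integral_nonneg zero_le_one fun _ _ => norm_nonneg _
    have hs : ∀ i j, n (fun x => P x i j) ≤ ∑ i, ∑ j, n fun x => P x i j := fun i j =>
      (Finset.single_le_sum (f := fun j => n fun x => P x i j) (fun j _ => hn _)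
        (Finset.mem_univ j)).trans
      (Finset.single_le_sum (f := fun i => ∑ j, n fun x => P x i j)
        (fun i _ => Finset.sum_nonneg fun j _ => hn _) (Finset.mem_univ i))
    have h0 := (hn _).trans (hs 0 0)
    refine ⟨1 + n σ₁ + n σ₂ + ∑ i, ∑ j, n fun x => P x i j, by linarith [hn σ₁, hn σ₂],
      ⟨hσ₁, ?_⟩, ⟨hσ₂, ?_⟩, fun i j => ⟨hP i j, ?_⟩⟩
    · change n σ₁ ≤ _
      linarith [hn σ₂]
    · change n σ₂ ≤ _
      linarith [hn σ₁]
    · exact (hs i j).trans (by linarith [hn σ₁, hn σ₂])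
  obtain ⟨S, hS1, b₁, b₂, bP⟩ := hex
  have hS0 : 0 ≤ S := by linarith
  -- The reciprocal of `6 E² (2S + 1)` works because it is itself at most 1, so that `2S + δ ≤ 2S +
  -- 1`.
  obtain ⟨δ, hδ, hsmall⟩ : ∃ δ : ℝ, 0 < δ ∧ 6 * E ^ 2 * ((2 * S + δ) * δ) ≤ 1 := by
    have hD : 1 ≤ 6 * E ^ 2 * (2 * S + 1) := by nlinarith [one_le_pow₀ hE1 (n := 2)]
    refine ⟨(6 * E ^ 2 * (2 * S + 1))⁻¹, by positivity, ?_⟩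
    have h1 := inv_le_one_of_one_le₀ hD
    have h2 := mul_inv_cancel₀ (show 6 * E ^ 2 * (2 * S + 1) ≠ 0 by positivity)
    set d := (6 * E ^ 2 * (2 * S + 1))⁻¹
    have hd : 0 ≤ d := by positivity
    have : 6 * E ^ 2 * ((2 * S + d) * d) ≤ 6 * E ^ 2 * ((2 * S + 1) * d) := by gcongr
    linarith
  have zb : L1Bound (fun _ => (0 : ℂ)) S := ⟨by simp, by simpa using hS0⟩
  obtain ⟨R₁, hR₁⟩ := eventually_smallSystem hr b₁ b₂ (bP 0 0) (bP 0 1) (bP 1 0) (bP 1 1) hδ hsmall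
  -- The unperturbed system is the case of zero perturbation.
  obtain ⟨R₂, hR₂⟩ := eventually_smallSystem hr b₁ b₂ zb zb zb zb hδ hsmall
  set A := 2 * (1 + E * (2 * S + δ)) with hA
  have hA0 : 0 ≤ A := by positivity
  set B := E * S * (E * S) + S + E * S + E * S * S with hB
  have hB0 : 0 ≤ B := by positivity
  set C₁ := A * (S + 2 * S * E) with hC₁
  have hC₁0 : 0 ≤ C₁ := by positivity
  set C₂ := A * (E * (2 * S * (A * (S + 2 * S * E)) +
    (2 * S * (1 + 2 * E * S) + (1 + E) * S) * (1 + S) + 2 + 2 * S * B)) with hC₂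
  have hC₂0 : 0 ≤ C₂ := by positivity
  -- `C₁` serves the errors measured by `gammaTilde`, `C₂` those measured by `rhoCore`; the summand
  -- 1 makes the constant positive.
  refine ⟨max 1 (max R₁ R₂), C₁ + C₂ + 1, by positivity, by positivity, fun μ hμ hlt => ?_⟩
  rw [max_lt_iff, max_lt_iff] at hlt
  obtain ⟨hμ1, hlt₁, hlt₂⟩ := hlt
  have s := hR₁ μ hμ hlt₁
  have s₀ : SmallSystem r μ (fun x => -σ₁ x) σ₂ (fun _ => 0) (fun _ => 0) (2 * S) δ := by
    simpa using hR₂ μ hμ hlt₂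
  obtain ⟨z₁, z₂, hz₁, hz₂, e₁, e₂⟩ := s₀.exists_solution (f₁ := fun _ => 1) (f₂ := fun _ => 0)
    continuousOn_const continuousOn_const
  obtain ⟨w₁, w₂, hw₁, hw₂, e₁', e₂'⟩ := s.exists_solution (f₁ := fun _ => 1) (f₂ := fun _ => 0)
    continuousOn_const continuousOn_const
  simp only [zero_add] at e₂ e₂'
  have cL := continuousOn_leftInt μ hσ₁
  have cR := continuousOn_rightInt μ hσ₂
  have cL' : ContinuousOn (leftInt μ σ₁) (uIcc 0 1) := by rwa [uIcc_of_le zero_le_one]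
  have cR' : ContinuousOn (rightInt μ σ₂) (uIcc 0 1) := by rwa [uIcc_of_le zero_le_one]
  have hG₁0 : 0 ≤ ∫ s in (0 : ℝ)..1, ‖σ₂ s‖ * gamma₀₁ σ₁ s μ ^ 2 :=
    intervalIntegral.integral_nonneg zero_le_one fun _ _ => by positivity
  have hG₂0 : 0 ≤ ∫ s in (0 : ℝ)..1, ‖σ₁ s‖ * gamma₀₂ σ₂ s μ ^ 2 :=
    intervalIntegral.integral_nonneg zero_le_one fun _ _ => by positivity
  set G := gammaTilde σ₁ σ₂ μ with hGdef
  have hG₁ : ∫ s in (0 : ℝ)..1, ‖σ₂ s‖ * ‖leftInt μ σ₁ s‖ ^ 2 ≤ G := le_add_of_nonneg_right hG₂0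
  have hG₂ : ∫ s in (0 : ℝ)..1, ‖σ₁ s‖ * ‖rightInt μ σ₂ s‖ ^ 2 ≤ G := le_add_of_nonneg_left hG₁0
  have hG0 : 0 ≤ G := hG₁0.trans hG₁
  have k₁ := b₁.mul_sqrt (by linarith) cR hG₂
  have k₂ := b₂.mul_sqrt (by linarith) cL hG₁
  set κ := Real.sqrt (S * G) with hκ
  have hκG : κ * κ = S * G := Real.mul_self_sqrt (by positivity)
  have hκ0 : 0 ≤ κ := Real.sqrt_nonneg _
  have hGb : L1Bound (fun t => σ₁ t * rightInt μ σ₂ t * rightInt μ σ₂ t) G := by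
    refine (L1Bound.of_le (intervalIntegrable_mul_cont (intervalIntegrable_mul_cont hσ₁ cR) cR)
      (hσ₁.norm.mul_continuousOn (cR'.norm.pow 2)) fun x _ => ?_).mono hG₂
    rw [norm_mul, norm_mul, mul_assoc, sq]
    exact le_rfl
  obtain ⟨hk, a₁, a₂⟩ := s₀.unperturbed_asymptotics k₁ hGb hz₁.continuousOn hz₂.continuousOn e₁ e₂
  rw [← hE, ← hA] at a₁ a₂
  have hAG : A * (κ * κ + 2 * S * (E * G)) = C₁ * G := by rw [hκG, hC₁]; ring
  have hkR := (b₂.mul hk).rightInt hr hμ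
  -- One bound for both `z₁ - 1` and `z₂ - R(σ₂)`: the error of the approximate solution plus its
  -- `K₁e` terms, which are of order `κ`.
  set Q := A * (κ * κ + 2 * S * (E * G)) + (1 + 2 * E * S) * κ with hQ
  have q₁ : SupBound (fun x => z₁ x - 1) Q := by
    refine ((a₁.sub hk).congr fun x _ => by ring).mono ?_
    have : 0 ≤ 2 * E * S * κ := by positivity
    linarith
  have q₂ : SupBound (fun x => z₂ x - rightInt μ σ₂ x) Q := by
    refine ((a₂.sub hkR).congr fun x _ => by ring).mono ?_
    have : 0 ≤ E * S * κ := by positivity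
    rw [← hE]
    linarith
  have hγL : ∀ x, ‖leftInt μ σ₁ x‖ ≤ gamma₀₁ σ₁ x μ + gamma₀₂ σ₂ x μ := fun x =>
    le_add_of_nonneg_right (norm_nonneg _)
  have hγR : ∀ x, ‖rightInt μ σ₂ x‖ ≤ gamma₀₁ σ₁ x μ + gamma₀₂ σ₂ x μ := fun x =>
    le_add_of_nonneg_left (norm_nonneg _)
  have hKR := fun i j => L1Bound.entry_mul_kP hσ₁ hσ₂ hP i j cR hγR
  have hKL := fun i j => L1Bound.entry_mul_kP hσ₁ hσ₂ hP i j cL hγL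
  set K := kP σ₁ σ₂ P μ with hK
  have hK0 := (hKR 0 0).nonneg
  obtain ⟨d₁, d₂⟩ := s.perturbed_asymptotics b₁ b₂ (bP 0 0) (bP 0 1) (bP 1 0) (bP 1 1) k₁ k₂
    (hKR 0 0) (hKR 0 1) (hKR 1 1) (hKL 1 0) hz₁.continuousOn hz₂.continuousOn e₁ e₂ q₁ q₂
    hw₁.continuousOn hw₂.continuousOn e₁' e₂' rfl rfl hE rfl hB rfl
  have hm1 : ‖μ⁻¹‖ ≤ 1 := by rw [norm_inv]; exact inv_le_one_of_one_le₀ hμ1.le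
  have hrem := remainder_le hE0 hS0 hA0 hB0 (norm_nonneg μ⁻¹) hm1 hK0 hG0 hκG hQ rfl
  have hrho : ‖μ⁻¹‖ * K + G + ‖μ⁻¹‖ ^ 2 = rhoCore σ₁ σ₂ P μ := by
    rw [rhoCore, norm_inv, inv_pow]
  rw [hrho] at hrem
  have hrho0 : 0 ≤ rhoCore σ₁ σ₂ P μ := by rw [← hrho]; positivity
  have hrem' := mul_le_mul_of_nonneg_left hrem hA0
  rw [← mul_assoc A _ (rhoCore σ₁ σ₂ P μ), ← hC₂] at hrem'
  rw [← hA] at d₁ d₂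
  have hfin : C₂ * rhoCore σ₁ σ₂ P μ ≤ (C₁ + C₂ + 1) * rhoCore σ₁ σ₂ P μ :=
    mul_le_mul_of_nonneg_right (by linarith) hrho0
  have hfinG : C₁ * G ≤ (C₁ + C₂ + 1) * G := mul_le_mul_of_nonneg_right (by linarith) hG0
  have hscale : ∀ (e u : ℂ) (M c ρ : ℝ), ‖u‖ ≤ M → M ≤ c * ρ → ‖e * u‖ ≤ c * ‖e‖ * ρ := by
    intro e u M c ρ h₁ h₂
    rw [norm_mul, mul_comm c, mul_assoc]
    exact mul_le_mul_of_nonneg_left (h₁.trans h₂) (norm_nonneg _)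
  refine ⟨_, _, diracMatrix_eq σ₁ σ₂ μ ▸ isSolution_exp_smul 1 s₀.ha.int s₀.hb.int s₀.hc.int
    s₀.hd.int hz₁ hz₂ e₁ e₂, ?_, ?_, perturbedMatrix_eq σ₁ σ₂ P μ ▸ isSolution_exp_smul 1 s.ha.int
    s.hb.int s.hc.int s.hd.int hw₁ hw₂ e₁' e₂', ?_, ?_, fun X hX => ?_, fun X hX => ?_,
    fun x hx => ⟨?_, ?_, ?_, ?_⟩⟩
  · simp [e₁ 0 (by simp), opT₁]
  · simp [e₂ 1 (by simp), opT₂, rightInt_one]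
  · simp [e₁' 0 (by simp), opT₁]
  · simp [e₂' 1 (by simp), opT₂, rightInt_one]
  · exact s₀.eq_zero_of_boundary (diracMatrix_eq σ₁ σ₂ μ ▸ hX)
  · exact s.eq_zero_of_boundary (perturbedMatrix_eq σ₁ σ₂ P μ ▸ hX)
  · refine Eq.trans_le (congrArg norm ?_) (hscale _ _ _ _ _ (d₁.le x hx) (hrem'.trans hfin))
    simp only [Matrix.cons_val_zero]
    ring
  · refine Eq.trans_le (congrArg norm ?_) (hscale _ _ _ _ _ (d₂.le x hx) (hrem'.trans hfin))
    simp only [Matrix.cons_val_one, Matrix.cons_val_fin_one]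
    ring
  · refine Eq.trans_le (congrArg norm ?_) (hscale _ _ _ _ _ (a₁.le x hx) (hAG.trans_le hfinG))
    simp only [Matrix.cons_val_zero]
    ring
  · refine Eq.trans_le (congrArg norm ?_) (hscale _ _ _ _ _ (a₂.le x hx) (hAG.trans_le hfinG))
    simp only [Matrix.cons_val_one, Matrix.cons_val_fin_one]
    ring

/-! ### Integrability of the coefficients and reflection of the data. -/

theorem intervalIntegrable_coeffMatrix {μ : ℂ} {a b c d : ℝ → ℂ}
    (ha : IntervalIntegrable a volume 0 1) (hb : IntervalIntegrable b volume 0 1)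
    (hc : IntervalIntegrable c volume 0 1) (hd : IntervalIntegrable d volume 0 1) (i j : Fin 2) :
    IntervalIntegrable (fun x => coeffMatrix μ a b c d x i j) volume 0 1 := by
  have hconst : ∀ k : ℂ, IntervalIntegrable (fun _ : ℝ => k) volume 0 1 := by simp
  fin_cases i <;> fin_cases j
  · exact (hconst _).add hc
  · exact ha
  · exact hb.neg
  · exact (hconst _).sub hd

theorem intervalIntegrable_perturbedMatrix {μ : ℂ} {σ₁ σ₂ : ℝ → ℂ}
    {P : ℝ → Matrix (Fin 2) (Fin 2) ℂ} (hσ₁ : IntervalIntegrable σ₁ volume 0 1)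
    (hσ₂ : IntervalIntegrable σ₂ volume 0 1)
    (hP : ∀ i j, IntervalIntegrable (fun x => P x i j) volume 0 1) (i j : Fin 2) :
    IntervalIntegrable (fun x => perturbedMatrix σ₁ σ₂ P μ x i j) volume 0 1 := by
  rw [perturbedMatrix_eq]
  exact intervalIntegrable_coeffMatrix (hσ₁.neg.add ((hP 0 1).const_mul _))
    (hσ₂.sub ((hP 1 0).const_mul _)) ((hP 0 0).const_mul _) ((hP 1 1).const_mul _).neg i j

theorem intervalIntegrable_diracMatrix {μ : ℂ} {σ₁ σ₂ : ℝ → ℂ}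
    (hσ₁ : IntervalIntegrable σ₁ volume 0 1) (hσ₂ : IntervalIntegrable σ₂ volume 0 1)
    (i j : Fin 2) : IntervalIntegrable (fun x => diracMatrix σ₁ σ₂ μ x i j) volume 0 1 := by
  rw [diracMatrix_eq]
  exact intervalIntegrable_coeffMatrix hσ₁.neg hσ₂ (by simp) (by simp) i j

/-- Reflection changes the sign of the derivative, and swapping the components changes the sign of
`diag(1, -1)`. The two cancel in `matA`; the potentials are interchanged and pick up a sign. -/
theorem diracMatrix_reflect (σ₁ σ₂ : ℝ → ℂ) (μ : ℂ) (x : ℝ) (i j : Fin 2) :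
    diracMatrix σ₁ σ₂ μ x i j =
      -diracMatrix (fun x => -σ₂ (1 - x)) (fun x => -σ₁ (1 - x)) μ (1 - x)
        (Fin.rev i) (Fin.rev j) := by
  fin_cases i <;> fin_cases j <;> simp [diracMatrix, matA, matJ]

theorem perturbedMatrix_reflect (σ₁ σ₂ : ℝ → ℂ) (P : ℝ → Matrix (Fin 2) (Fin 2) ℂ) (μ : ℂ)
    (x : ℝ) (i j : Fin 2) :
    perturbedMatrix σ₁ σ₂ P μ x i j =
      -perturbedMatrix (fun x => -σ₂ (1 - x)) (fun x => -σ₁ (1 - x))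
        (fun x => -(P (1 - x)).submatrix Fin.rev Fin.rev) μ (1 - x) (Fin.rev i) (Fin.rev j) := by
  fin_cases i <;> fin_cases j <;> simp [perturbedMatrix, matA, matJ] <;> ring

theorem opK₁_reflect (σ₁ σ₂ : ℝ → ℂ) (μ : ℂ) (x : ℝ) :
    opK₁ (fun x => -σ₂ (1 - x)) (fun x => -σ₁ (1 - x)) μ oneFun (1 - x) =
      opK₂ σ₁ σ₂ μ oneFun x := by
  have h := intervalIntegral.integral_comp_sub_left (a := 0) (b := 1 - x)
    (fun t => σ₂ t * leftInt μ σ₁ t) 1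
  rw [sub_zero, sub_sub_cancel] at h
  rw [opK₁_one, opK₂]
  simp only [oneFun, mul_one]
  rw [← h]
  congr 1
  ext t
  rw [rightInt_neg, rightInt_comp_sub, neg_mul_neg]

end DiracSystem

theorem mainTheorem6 (p q : ℝ≥0∞) (hp₁ : 1 ≤ p) (hp₂ : p ≤ 2) (hpq : p⁻¹ + q⁻¹ = 1)
    (σ₁ σ₂ : ℝ → ℂ)
    (hσ₁ : MemLp σ₁ p (volume.restrict (Icc (0 : ℝ) 1)))
    (hσ₂ : MemLp σ₂ p (volume.restrict (Icc (0 : ℝ) 1)))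
    (P : ℝ → Matrix (Fin 2) (Fin 2) ℂ)
    (hP : ∀ i j, IntegrableOn (fun x => P x i j) (Icc (0 : ℝ) 1))
    (r : ℝ) (hr : 0 ≤ r) :
    ∃ R C : ℝ, 0 < R ∧ 0 < C ∧ ∃ W V W' V' : ℂ → ℝ → Fin 2 → ℂ,
      ∀ μ ∈ DiracSystem.halfPlane r, R < ‖μ‖ →
        -- `W`, `V`: the normalised fundamental system of the unperturbed system
        DiracSystem.IsFundamentalSystem (DiracSystem.diracMatrix σ₁ σ₂ μ) (W μ) (V μ) ∧
        W μ 0 0 = 1 ∧ W μ 1 1 = 0 ∧ V μ 0 0 = 0 ∧ V μ 1 1 = 1 ∧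
        -- `W'`, `V'`: a fundamental system of the perturbed system
        DiracSystem.IsFundamentalSystem (DiracSystem.perturbedMatrix σ₁ σ₂ P μ) (W' μ) (V' μ) ∧
        ∀ x ∈ Icc (0 : ℝ) 1,
          -- asymptotics of `W'`
          ‖W' μ x 0 - W μ x 0 - Complex.exp (Complex.I * μ * x) / μ *
              (DiracSystem.leftInt μ σ₁ x * DiracSystem.rightInt μ (fun t => P t 1 0) x
                + ∫ t in (0 : ℝ)..x, P t 0 0)‖
            ≤ C * ‖Complex.exp (Complex.I * μ * x)‖ * DiracSystem.rho q σ₁ σ₂ P μ ∧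
          ‖W' μ x 1 - W μ x 1 - Complex.exp (Complex.I * μ * x) / μ *
              (-DiracSystem.rightInt μ (fun t => P t 1 0) x
                + DiracSystem.rightInt μ σ₂ x * ∫ t in (0 : ℝ)..x, P t 0 0)‖
            ≤ C * ‖Complex.exp (Complex.I * μ * x)‖ * DiracSystem.rho q σ₁ σ₂ P μ ∧
          -- asymptotics of `V'`
          ‖V' μ x 0 - V μ x 0 - Complex.exp (Complex.I * μ * (1 - x)) / μ *
              (DiracSystem.leftInt μ (fun t => P t 0 1) x
                + DiracSystem.leftInt μ σ₁ x * ∫ t in x..(1 : ℝ), P t 1 1)‖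
            ≤ C * ‖Complex.exp (Complex.I * μ * (1 - x))‖ * DiracSystem.rho q σ₁ σ₂ P μ ∧
          ‖V' μ x 1 - V μ x 1 - Complex.exp (Complex.I * μ * (1 - x)) / μ *
              (DiracSystem.rightInt μ σ₂ x * DiracSystem.leftInt μ (fun t => P t 0 1) x
                - ∫ t in x..(1 : ℝ), P t 1 1)‖
            ≤ C * ‖Complex.exp (Complex.I * μ * (1 - x))‖ * DiracSystem.rho q σ₁ σ₂ P μ ∧
          -- asymptotics of `W`
          ‖W μ x 0 - Complex.exp (Complex.I * μ * x) *
              (1 - DiracSystem.opK₁ σ₁ σ₂ μ DiracSystem.oneFun x)‖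
            ≤ C * ‖Complex.exp (Complex.I * μ * x)‖ * DiracSystem.gammaTilde σ₁ σ₂ μ ∧
          ‖W μ x 1 - Complex.exp (Complex.I * μ * x) *
              (DiracSystem.rightInt μ σ₂ x - DiracSystem.rightInt μ
                (fun t => σ₂ t * DiracSystem.opK₁ σ₁ σ₂ μ DiracSystem.oneFun t) x)‖
            ≤ C * ‖Complex.exp (Complex.I * μ * x)‖ * DiracSystem.gammaTilde σ₁ σ₂ μ ∧
          -- asymptotics of `V`
          ‖V μ x 0 - Complex.exp (Complex.I * μ * (1 - x)) *
              (-DiracSystem.leftInt μ σ₁ x + DiracSystem.leftInt μ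
                (fun t => σ₁ t * DiracSystem.opK₂ σ₁ σ₂ μ DiracSystem.oneFun t) x)‖
            ≤ C * ‖Complex.exp (Complex.I * μ * (1 - x))‖ * DiracSystem.gammaTilde σ₁ σ₂ μ ∧
          ‖V μ x 1 - Complex.exp (Complex.I * μ * (1 - x)) *
              (1 - DiracSystem.opK₂ σ₁ σ₂ μ DiracSystem.oneFun x)‖
            ≤ C * ‖Complex.exp (Complex.I * μ * (1 - x))‖ * DiracSystem.gammaTilde σ₁ σ₂ μ := by
  have hI : ∀ {f : ℝ → ℂ}, IntegrableOn f (Icc (0 : ℝ) 1) → IntervalIntegrable f volume 0 1 :=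
    fun hf => (intervalIntegrable_iff_integrableOn_Icc_of_le zero_le_one).2 hf
  have i₁ : IntervalIntegrable σ₁ volume 0 1 := hI (hσ₁.integrable hp₁)
  have i₂ : IntervalIntegrable σ₂ volume 0 1 := hI (hσ₂.integrable hp₁)
  have iP := fun i j => hI (hP i j)
  have j₁ : IntervalIntegrable (fun x => -σ₁ (1 - x)) volume 0 1 :=
    (DiracSystem.intervalIntegrable_comp_sub i₁).neg
  have j₂ : IntervalIntegrable (fun x => -σ₂ (1 - x)) volume 0 1 :=
    (DiracSystem.intervalIntegrable_comp_sub i₂).neg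
  have jP : ∀ i j, IntervalIntegrable
      (fun x => (-(P (1 - x)).submatrix Fin.rev Fin.rev) i j) volume 0 1 := fun i j =>
    (DiracSystem.intervalIntegrable_comp_sub (iP (Fin.rev i) (Fin.rev j))).neg
  obtain ⟨R₁, C₁, hR₁, hC₁, H₁⟩ := DiracSystem.exists_normalised_solutions hr i₁ i₂ iP
  obtain ⟨R₂, C₂, hR₂, hC₂, H₂⟩ := DiracSystem.exists_normalised_solutions hr j₂ j₁ jP
  choose! W W' H₁ using H₁
  choose! U U' H₂ using H₂
  -- `V` and `V'` are the reflections of the normalised solutions `U`, `U'` for the reflected data: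
  -- `V₁(0) = U₂(1) = 0` and `V₂(1) = U₁(0) = 1`.
  refine ⟨max R₁ R₂, max C₁ C₂, by positivity, by positivity, W,
    fun μ x i => U μ (1 - x) (Fin.rev i), W', fun μ x i => U' μ (1 - x) (Fin.rev i),
    fun μ hμ hlt => ?_⟩
  rw [max_lt_iff] at hlt
  obtain ⟨sW, W₀, W₁, sW', W₀', W₁', uD, uP, hW⟩ := H₁ μ hμ hlt.1
  obtain ⟨sU, U₀, U₁, sU', U₀', U₁', -, -, hU⟩ := H₂ μ hμ hlt.2
  have r₀ : Fin.rev (0 : Fin 2) = 1 := rfl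
  have r₁ : Fin.rev (1 : Fin 2) = 0 := rfl
  have sV := sU.reflect (DiracSystem.intervalIntegrable_diracMatrix j₂ j₁)
    (DiracSystem.diracMatrix_reflect σ₁ σ₂ μ)
  have sV' := sU'.reflect (DiracSystem.intervalIntegrable_perturbedMatrix j₂ j₁ jP)
    (DiracSystem.perturbedMatrix_reflect σ₁ σ₂ P μ)
  have hbound : ∀ {n e ρ ρ' c : ℝ}, n ≤ c * e * ρ → 0 < c → 0 ≤ n → c ≤ max C₁ C₂ → 0 < e →
      ρ ≤ ρ' → n ≤ max C₁ C₂ * e * ρ' := by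
    intro n e ρ ρ' c h hc hn hcc he hρ
    -- Nonnegativity of the error quantity is read off from the bound itself, whose left side is a
    -- norm.
    have hρ0 : 0 ≤ ρ := by
      by_contra! hneg
      nlinarith [mul_pos hc he]
    refine h.trans ?_
    gcongr
  have hexp : ∀ k : ℂ, 0 < ‖Complex.exp k‖ := fun k => norm_pos_iff.2 (Complex.exp_ne_zero k)
  have hrho := DiracSystem.rhoCore_le_rho q σ₁ σ₂ P μ
  refine ⟨DiracSystem.isFundamentalSystem_of_unique sW sV W₀ W₁ ?_ ?_ uD, W₀, W₁, ?_, ?_,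
    DiracSystem.isFundamentalSystem_of_unique sW' sV' W₀' W₁' ?_ ?_ uP, fun x hx => ?_⟩
  iterate 6 simpa [r₀, r₁]
  obtain ⟨a₁, a₂, a₃, a₄⟩ := hW x hx
  obtain ⟨b₁, b₂, b₃, b₄⟩ := hU (1 - x) (DiracSystem.one_sub_mem hx)
  have hint : ∫ t in (0 : ℝ)..(1 - x), P (1 - t) 1 1 = ∫ t in x..(1 : ℝ), P t 1 1 := by
    have h := intervalIntegral.integral_comp_sub_left (a := 0) (b := 1 - x) (fun t => P t 1 1) 1
    rwa [sub_zero, sub_sub_cancel] at h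
  have hk : DiracSystem.leftInt μ (fun t => σ₁ t * DiracSystem.opK₂ σ₁ σ₂ μ DiracSystem.oneFun t) x =
      DiracSystem.rightInt μ (fun t => σ₁ (1 - t) * DiracSystem.opK₁ (fun x => -σ₂ (1 - x))
        (fun x => -σ₁ (1 - x)) μ DiracSystem.oneFun t) (1 - x) := by
    rw [← sub_sub_cancel 1 x, ← DiracSystem.rightInt_comp_sub, sub_sub_cancel]
    congr 1
    ext t
    rw [← DiracSystem.opK₁_reflect, sub_sub_cancel]
  simp only [DiracSystem.rhoCore, DiracSystem.kP_reflect, DiracSystem.gammaTilde_reflect] at b₁ b₂ b₃ b₄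
  rw [← DiracSystem.rhoCore] at b₁ b₂
  simp only [Matrix.neg_apply, Matrix.submatrix_apply, r₀, r₁, neg_mul, DiracSystem.leftInt_neg,
    DiracSystem.rightInt_neg, DiracSystem.leftInt_comp_sub μ σ₂,
    DiracSystem.rightInt_comp_sub μ (fun t => P t 0 1), DiracSystem.rightInt_comp_sub μ σ₁,
    intervalIntegral.integral_neg, hint, ← hk, DiracSystem.opK₁_reflect, sub_sub_cancel,
    Complex.ofReal_sub, Complex.ofReal_one] at b₁ b₂ b₃ b₄
  simp only [r₀, r₁]
  -- The swap of components pairs the first component of `V` with the second estimate for `U`, and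
  -- conversely.
  refine ⟨hbound a₁ hC₁ (norm_nonneg _) (le_max_left _ _) (hexp _) hrho,
    hbound a₂ hC₁ (norm_nonneg _) (le_max_left _ _) (hexp _) hrho,
    hbound ((congrArg norm ?_).trans_le b₂) hC₂ (norm_nonneg _) (le_max_right _ _) (hexp _) hrho,
    hbound ((congrArg norm ?_).trans_le b₁) hC₂ (norm_nonneg _) (le_max_right _ _) (hexp _) hrho,
    hbound a₃ hC₁ (norm_nonneg _) (le_max_left _ _) (hexp _) le_rfl,
    hbound a₄ hC₁ (norm_nonneg _) (le_max_left _ _) (hexp _) le_rfl,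
    hbound ((congrArg norm ?_).trans_le b₄) hC₂ (norm_nonneg _) (le_max_right _ _) (hexp _) le_rfl,
    hbound b₃ hC₂ (norm_nonneg _) (le_max_right _ _) (hexp _) le_rfl⟩
  all_goals ring
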